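/- Let $n\ge 2$ and let $su(n)$ be the real Lie algebra of antihermitian traceless complex $n\times n$ matrices, of rank $l=n-1$. Let $\mathcal V^{(m)}$ be the real vector space of invariant symmetric tensors (polynomials) of order $m$ on $su(n)$: the totally symmetric $m$-linear maps $h:su(n)^m\to\mathbb R$ with $\sum_{s=1}^m h(X_1,\dots,[Y,X_s],\dots,X_m)=0$ for all $Y,X_1,\dots,X_m$. The product of two tensors is their tensor product symmetrised with unit weight. Let $\mathcal D^{(m)}$ be the linear span of the symmetrised products of an element of $\mathcal V^{(p)}$ and an element of $\mathcal V^{(q)}$, $p,q\ge 1$, $p+q=m$; an $h\in\mathcal V^{(m)}$, $m\ge1$, is called primitive if $h\notin\mathcal D^{(m)}$. Let $k^{(m)}(X_1,\dots,X_m)=\frac1{m!}\sum_{\sigma\in S_m}\mathrm{Tr}(T_{\sigma(1)}\cdots T_{\sigma(m)})$ with $T_j=iX_j$ be the (real) symmetric-trace tensor of order $m$, so that $\frac1{m!}\sum_{\sigma}\mathrm{Tr}(X_{\sigma(1)}\cdots X_{\sigma(m)})=(-i)^m k^{(m)}(X_1,\dots,X_m)$; it belongs to $\mathcal V^{(m)}$.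 For a partition $\mu$ of $m$ let $k_\mu$ be the symmetrised product of the $k^{(p)}$, $p$ running over the parts of $\mu$ (with multiplicity; for the empty partition, $k_\mu=1$). Lemma (Invariant symmetric polynomials on $su(n)$). 1. There are $l=n-1$ primitive invariant symmetric polynomials, one for each of the orders $2,3,\dots,n$: for $2\le m\le n$ the tensor $k^{(m)}$ is primitive, and for every $h\in\mathcal V^{(m)}$ there is exactly one $c\in\mathbb R$ with $h-c\,k^{(m)}\in\mathcal D^{(m)}$; and a primitive invariant symmetric tensor of order $m$ exists if and only if $2\le m\le n$. 2. For every $m\ge 0$ the products $k_\mu$, with $\mu$ running over the partitions of $m$ into parts from $\{2,\dots,n\}$, form a basis of $\mathcal V^{(m)}$. In particular, for $m>n$ the tensor $k^{(m)}$ is not primitive and is a linear combination of products of $k^{(2)},\dots,k^{(n)}$. 3. Put $\epsilon_{\alpha_1\dots\alpha_m}^{\beta_1\dots\beta_m}=\sum_{\sigma\in S_m}\mathrm{sgn}(\sigma)\,\delta_{\alpha_1}^{\beta_{\sigma(1)}}\cdots\delta_{\alpha_m}^{\beta_{\sigma(m)}}$. If $m>n$ (for instance $m=n+1$) then, for all complex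 $n\times n$ matrices $A_1,\dots,A_m$ and with summation over all indices from $1$ to $n$, $$\epsilon_{\alpha_1\dots\alpha_m}^{\beta_1\dots\beta_m}(A_1)^{\alpha_1}{}_{\beta_1}\cdots(A_m)^{\alpha_m}{}_{\beta_m}=0 .$$ For every $m$ and all $X_j\in su(n)$, $T_j=iX_j$, $$\epsilon_{\alpha_1\dots\alpha_m}^{\beta_1\dots\beta_m}(T_1)^{\alpha_1}{}_{\beta_1}\cdots(T_m)^{\alpha_m}{}_{\beta_m}=\sum_{\mu\vdash m}(-1)^{\nu_2+\nu_4+\cdots}\,\frac{m!}{\prod_j \nu_j!\,j^{\nu_j}}\;k_\mu(X_1,\dots,X_m),$$ where $\nu_j$ is the multiplicity of $j$ in $\mu$. Hence for $m>n$ $$(-1)^m (m-1)!\;k^{(m)}=\sum_{\mu\vdash m,\ \mu\ne[m]}(-1)^{\nu_2+\nu_4+\cdots}\,\frac{m!}{\prod_j \nu_j!\,j^{\nu_j}}\;k_\mu ,$$ which expresses $k^{(m)}$ through products of symmetric-trace tensors of lower order. -/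

import Mathlib

attribute [local instance] LieRing.ofAssociativeRing LieAlgebra.ofAssociativeAlgebra

namespace SuInvariants

open scoped Nat

noncomputable section

/-- The real Lie algebra `su(n)` of antihermitian traceless complex `n × n` matrices,
with the commutator as bracket. -/
def su (n : ℕ) : LieSubalgebra ℝ (Matrix (Fin n) (Fin n) ℂ) where
  carrier := {A | A.conjTranspose = -A ∧ A.trace = 0}
  add_mem' := by
    rintro A B ⟨hA, hA'⟩ ⟨hB, hB'⟩
    refine ⟨?_, by simp [hA', hB']⟩
    rw [Matrix.conjTranspose_add, hA, hB, neg_add]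
  zero_mem' := by simp
  smul_mem' := by
    rintro c A ⟨hA, hA'⟩
    refine ⟨?_, by simp [hA']⟩
    rw [Matrix.conjTranspose_smul, hA, star_trivial, smul_neg]
  lie_mem' := by
    rintro A B ⟨hA, -⟩ ⟨hB, -⟩
    refine ⟨?_, ?_⟩
    · rw [Ring.lie_def, Matrix.conjTranspose_sub, Matrix.conjTranspose_mul,
        Matrix.conjTranspose_mul, hA, hB]
      simp
    · rw [Ring.lie_def, Matrix.trace_sub, Matrix.trace_mul_comm, sub_self]

/-- Real covariant tensors of order `m` on `su(n)`. -/
abbrev Tensor (n m : ℕ) : Type :=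
  MultilinearMap ℝ (fun _ : Fin m => su n) ℝ

/-- Invariance under the adjoint action: for all `Y, X₁, …, Xₘ` in `su(n)`,
`∑ₛ h(X₁, …, [Y, Xₛ], …, Xₘ) = 0`. -/
def IsInvariant {n m : ℕ} (h : Tensor n m) : Prop :=
  ∀ (Y : su n) (X : Fin m → su n), ∑ s, h (Function.update X s ⁅Y, X s⁆) = 0

/-- Total symmetry. -/
def IsSymm {n m : ℕ} (h : Tensor n m) : Prop :=
  ∀ (σ : Equiv.Perm (Fin m)) (X : Fin m → su n), h (fun j => X (σ j)) = h X

/-- The space of invariant symmetric tensors (invariant symmetric polynomials) of order `m`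
on `su(n)`. -/
def invSymm (n m : ℕ) : Submodule ℝ (Tensor n m) where
  carrier := {h | IsInvariant h ∧ IsSymm h}
  add_mem' := by
    rintro f g ⟨hf, hf'⟩ ⟨hg, hg'⟩
    refine ⟨fun Y X => ?_, fun σ X => ?_⟩
    · simp only [add_apply, Finset.sum_add_distrib]
      rw [hf Y X, hg Y X, add_zero]
    · simp only [add_apply]
      rw [hf' σ X, hg' σ X]
  zero_mem' := ⟨fun _ _ => by simp, fun _ _ => by simp⟩
  smul_mem' := by
    rintro c f ⟨hf, hf'⟩
    refine ⟨fun Y X => ?_, fun σ X => ?_⟩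
    · simp only [smul_apply]
      rw [← Finset.smul_sum, hf Y X, smul_zero]
    · simp only [smul_apply]
      rw [hf' σ X]

/-- Unit weight symmetrisation
`h_(i₁ … iₘ) = (1 / m!) ∑_σ h_{i_σ(1) … i_σ(m)}`. -/
def symmetrise {n m : ℕ} (h : Tensor n m) : Tensor n m :=
  (m ! : ℝ)⁻¹ • ∑ σ : Equiv.Perm (Fin m), h.domDomCongr σ

/-- The tensor product
`(f ⊗ g)(X₁, …, X_{p+q}) = f(X₁, …, X_p) g(X_{p+1}, …, X_{p+q})`. -/
def tensorMul {n p q : ℕ} (f : Tensor n p) (g : Tensor n q) : Tensor n (p + q) :=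
  ((LinearMap.mul' ℝ ℝ).compMultilinearMap (f.domCoprod g)).domDomCongr finSumFinEquiv

/-- The symmetrised product `f_(i₁ … i_p g_j₁ … j_q)`. -/
def symMul {n p q : ℕ} (f : Tensor n p) (g : Tensor n q) : Tensor n (p + q) :=
  symmetrise (tensorMul f g)

/-- Transport of the order of a tensor along an equality. -/
def castOrder {n p m : ℕ} (h : p = m) (f : Tensor n p) : Tensor n m :=
  f.domDomCongr (finCongr h)

/-- The space spanned by the symmetrised products of two invariant symmetric tensors of lower
positive orders `p + q = m`. -/
def decomposable (n m : ℕ) : Submodule ℝ (Tensor n m) :=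
  Submodule.span ℝ {h | ∃ (p q : ℕ) (e : p + q = m), 0 < p ∧ 0 < q ∧
    ∃ f ∈ invSymm n p, ∃ g ∈ invSymm n q, h = castOrder e (symMul f g)}

/-- A primitive invariant symmetric tensor: one of positive order which is not a combination of
products of invariant symmetric tensors of lower order. -/
def IsPrimitive {n m : ℕ} (h : Tensor n m) : Prop :=
  0 < m ∧ h ∈ invSymm n m ∧ h ∉ decomposable n m

/-- The hermitian matrix `T = i X` of `X ∈ su(n)` (so that `X = -i T`), as a real linear map. -/
def herm (n : ℕ) : su n →ₗ[ℝ] Matrix (Fin n) (Fin n) ℂ where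
  toFun X := Complex.I • (X : Matrix (Fin n) (Fin n) ℂ)
  map_add' X Y := by simp
  map_smul' c X := by simpa using smul_comm Complex.I c (X : Matrix (Fin n) (Fin n) ℂ)

/-- The real part of the trace, as a real linear map. -/
def reTrace (n : ℕ) : Matrix (Fin n) (Fin n) ℂ →ₗ[ℝ] ℝ :=
  Complex.reLm ∘ₗ Matrix.traceLinearMap (Fin n) ℝ ℂ

/-- The unit weight symmetrised trace
`Tr(A_(1 ⋯ A_m)) = (1 / m!) ∑_σ Tr(A_σ(1) ⋯ A_σ(m))` of complex matrices. -/
def symTrace {n m : ℕ} (A : Fin m → Matrix (Fin n) (Fin n) ℂ) : ℂ :=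
  (m ! : ℂ)⁻¹ * ∑ σ : Equiv.Perm (Fin m), (List.ofFn fun j => A (σ j)).prod.trace

/-- The symmetric-trace tensor `k⁽ᵐ⁾(X₁, …, Xₘ) = Tr(T_(1 ⋯ T_m))` in terms of the hermitian
matrices `Tⱼ = i Xⱼ`. The symmetrised trace of hermitian matrices is real, so taking the real part
only serves to land in `ℝ`. -/
def k (n m : ℕ) : Tensor n m :=
  symmetrise ((reTrace n).compMultilinearMap
    ((MultilinearMap.mkPiAlgebraFin ℝ m (Matrix (Fin n) (Fin n) ℂ)).compLinearMap
      fun _ => herm n))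

/-- The symmetrised product of the symmetric-trace tensors whose orders are listed in `L`. -/
def kList (n : ℕ) : (L : List ℕ) → Tensor n L.sum
  | [] => (MultilinearMap.constOfIsEmpty ℝ (fun _ : Fin 0 => su n) (1 : ℝ) : Tensor n 0)
  | m :: L => symMul (k n m) (kList n L)

/-- The symmetrised product of the `k⁽ᵖ⁾`, with `p` running over the parts of the partition `μ`
of `m`. -/
def kPart (n : ℕ) {m : ℕ} (μ : m.Partition) : Tensor n m :=
  castOrder
    (by rw [← Multiset.sum_coe, Multiset.sort_eq, μ.parts_sum])
    (kList n (μ.parts.sort (· ≤ ·)))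

/-- The partitions of `m` into parts from `{2, …, n}`: the monomials of order `m` in
`k⁽²⁾, …, k⁽ⁿ⁾`. -/
abbrev Monomials (n m : ℕ) : Type :=
  {μ : m.Partition // ∀ p ∈ μ.parts, 2 ≤ p ∧ p ≤ n}

/-- The tensor
`ε_{α₁ … αₘ}^{β₁ … βₘ} = ∑_σ sgn(σ) δ_{α₁}^{β_σ(1)} ⋯ δ_{αₘ}^{β_σ(m)}`. -/
def eps {n m : ℕ} (α β : Fin m → Fin n) : ℤ :=
  ∑ σ : Equiv.Perm (Fin m), (Equiv.Perm.sign σ : ℤ) * ∏ j, if α j = β (σ j) then 1 else 0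

/-- The antisymmetrised contraction
`ε_{α₁ … αₘ}^{β₁ … βₘ} (A₁)^{α₁}_{β₁} ⋯ (Aₘ)^{αₘ}_{βₘ}`, summed over all matrix indices. -/
def antisymTrace {n m : ℕ} (A : Fin m → Matrix (Fin n) (Fin n) ℂ) : ℂ :=
  ∑ α : Fin m → Fin n, ∑ β : Fin m → Fin n, (eps α β : ℂ) * ∏ j, A j (α j) (β j)

/-- The number `m! / (ν₁! 1^ν₁ ν₂! 2^ν₂ ⋯)` of permutations of `m` objects whose cycle lengths
are the parts of `μ`, where `ν_j` is the multiplicity of `j` in `μ`. -/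
def cauchyNumber {m : ℕ} (μ : m.Partition) : ℝ :=
  (m ! : ℝ) / ∏ j ∈ μ.parts.toFinset, ((μ.parts.count j)! * j ^ μ.parts.count j : ℝ)

/-- The parity `(-1)^(ν₂ + ν₄ + ν₆ + ⋯)` of these permutations. -/
def cycleSign {m : ℕ} (μ : m.Partition) : ℝ :=
  (-1) ^ (μ.parts.filter Even).card

end

end SuInvariants

namespace SuInvariants

open scoped Nat

/-! Everything is reduced to symmetric polynomials in eigenvalues. By polarisation a symmetric
tensor `h` is determined by the values `h(X, …, X)`; there symmetrised products become ordinary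
products (`symMul_diag`), and `k⁽ᵖ⁾` becomes the `p`-th power sum of the eigenvalues of `iX`.

An invariant symmetric tensor is determined by its restriction to the diagonal matrices
(`eq_zero_of_cartan`), an infinitesimal form of the fact that every `X` is conjugate to a diagonal
matrix. The restriction is a homogeneous polynomial, and it is symmetric because rotations in a
coordinate plane realise the transpositions (`IsInvariant.diagEl_swap`). The symmetric polynomials
in `n` variables are generated by the sum of the variables and the centred power sums of degrees `2,
…, n`. These are `n` generators of an algebra of transcendence degree `n`, hence algebraically
independent (`algebraicIndependent_symmGen`). Tracelessness removes the first generator, so the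
monomials in `k⁽²⁾, …, k⁽ⁿ⁾` form a basis. The monomials with at least two factors span the
decomposable tensors, so modulo these only `k⁽ᵐ⁾` with `2 ≤ m ≤ n` survives.

The antisymmetrised contraction of one hermitian matrix is `m!` times the elementary symmetric
function `e_m` of its eigenvalues. Newton's identities expand `e_m` in power sums
(`eval_esymm_eq_sum`), and polarisation turns this into the expansion in the `k_μ`. For `m > n` an
index must repeat, so the contraction vanishes and the expansion can be solved for `k⁽ᵐ⁾`. -/

/-- Polarisation: a symmetric multilinear map that vanishes on the diagonal is zero. -/
theorem multilinear_eq_zero_of_diag {ι E F : Type*} [Fintype ι] [AddCommGroup E] [Module ℝ E]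
    [AddCommGroup F] [Module ℝ F] (f : MultilinearMap ℝ (fun _ : ι => E) F)
    (hs : ∀ (σ : Equiv.Perm ι) (v : ι → E), f (fun j => v (σ j)) = f v)
    (h0 : ∀ x, f (fun _ => x) = 0) : f = 0 := by
  classical
  ext v
  -- Inclusion-exclusion over the subsets `t` of the arguments: after expansion only the terms that
  -- use every `v i` exactly once survive.
  have key : ∑ t : ι → Bool, (∏ i, (if t i then (1 : ℝ) else -1)) •
      f (fun _ => ∑ i, (if t i then (1 : ℝ) else 0) • v i) = ((Fintype.card ι)! : ℝ) • f v := by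
    have h1 : ∀ t : ι → Bool, f (fun _ => ∑ i, (if t i then (1 : ℝ) else 0) • v i) =
        ∑ r : ι → ι, (∏ j, (if t (r j) then (1 : ℝ) else 0)) • f (fun j => v (r j)) := by
      intro t
      rw [f.map_sum (fun _ i => (if t i then (1 : ℝ) else 0) • v i)]
      refine Finset.sum_congr rfl fun r _ => ?_
      rw [← f.map_smul_univ]
    simp_rw [h1, Finset.smul_sum, smul_smul]
    rw [Finset.sum_comm]
    simp_rw [← Finset.sum_smul]
    have h2 : ∀ r : ι → ι, (∑ t : ι → Bool,
        (∏ i, (if t i then (1 : ℝ) else -1)) * ∏ j, (if t (r j) then (1 : ℝ) else 0)) =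
        if Function.Bijective r then 1 else 0 := by
      intro r
      have h3 : ∀ t : ι → Bool,
          (∏ i, (if t i then (1 : ℝ) else -1)) * ∏ j, (if t (r j) then (1 : ℝ) else 0) =
          ∏ i, ((if t i then (1 : ℝ) else -1) *
            (if t i then (1 : ℝ) else 0) ^ (Finset.univ.filter fun j => r j = i).card) := by
        intro t
        rw [Finset.prod_mul_distrib]
        congr 1
        rw [← Finset.prod_fiberwise Finset.univ r]
        refine Finset.prod_congr rfl fun i _ => ?_
        rw [← Finset.prod_const]
        refine Finset.prod_congr rfl fun j hj => ?_
        rw [(Finset.mem_filter.mp hj).2]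
      simp_rw [h3]
      -- The sum over `t` factorises over `i`. The factor at `i` is `1 - 0 ^ c`, with `c` the size
      -- of the fibre of `r` over `i`; since `0 ^ 0 = 1` it vanishes exactly when `i` is not hit.
      rw [← Fintype.prod_sum (fun i (b : Bool) => ((if b then (1 : ℝ) else -1) *
            (if b then (1 : ℝ) else 0) ^ (Finset.univ.filter fun j => r j = i).card))]
      split_ifs with hr
      · refine Finset.prod_eq_one fun i _ => ?_
        obtain ⟨j, hj⟩ := hr.2 i
        have : (Finset.univ.filter fun j => r j = i).card ≠ 0 :=
          (Finset.card_pos.mpr ⟨j, by simp [hj]⟩).ne'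
        simp [this]
      · have : ¬ Function.Surjective r := fun h => hr (Finite.surjective_iff_bijective.mp h)
        simp only [Function.Surjective, not_forall, not_exists] at this
        obtain ⟨i, hi⟩ := this
        refine Finset.prod_eq_zero (Finset.mem_univ i) ?_
        have : (Finset.univ.filter fun j => r j = i) = ∅ := by
          ext j; simp [hi j]
        simp [this]
    simp_rw [h2, ite_smul, one_smul, zero_smul]
    rw [← Finset.sum_filter]
    have h4 : ∑ r ∈ (Finset.univ : Finset (ι → ι)).filter Function.Bijective,
        f (fun j => v (r j)) = ∑ σ : Equiv.Perm ι, f (fun j => v (σ j)) := by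
      symm
      refine Finset.sum_bij (fun σ _ => (σ : ι → ι)) ?_ ?_ ?_ ?_
      · intro σ _
        exact Finset.mem_filter.mpr ⟨Finset.mem_univ _, σ.bijective⟩
      · intro σ _ τ _ h
        exact DFunLike.coe_injective h
      · intro r hr
        exact ⟨Equiv.ofBijective r (Finset.mem_filter.mp hr).2, Finset.mem_univ _, rfl⟩
      · intro σ _
        rfl
    rw [h4]
    simp_rw [hs]
    rw [Finset.sum_const, Finset.card_univ, Fintype.card_perm,
      Nat.cast_smul_eq_nsmul]
  simp only [h0, smul_zero, Finset.sum_const_zero] at key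
  have : ((Fintype.card ι)! : ℝ) ≠ 0 := by positivity
  simpa [this] using key.symm

/-- Polarisation applied to `f - g`. Identities between symmetrised products are checked through
this, since symmetrisation is invisible on the diagonal. -/
theorem eq_of_diag {n m : ℕ} {f g : Tensor n m} (hf : IsSymm f) (hg : IsSymm g)
    (h : ∀ X, f (fun _ => X) = g (fun _ => X)) : f = g := by
  rw [← sub_eq_zero]
  refine multilinear_eq_zero_of_diag _ (fun σ v => ?_) (fun x => ?_)
  · rw [sub_apply, sub_apply, hf σ v, hg σ v]
  · rw [sub_apply, h x, sub_self]

/-! ### Symmetrisation and products of invariant tensors -/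

theorem symmetrise_apply {n m : ℕ} (h : Tensor n m) (X : Fin m → su n) :
    symmetrise h X = (m ! : ℝ)⁻¹ * ∑ σ : Equiv.Perm (Fin m), h (fun j => X (σ j)) := by
  simp [symmetrise]

theorem symmetrise_isSymm {n m : ℕ} (h : Tensor n m) : IsSymm (symmetrise h) := by
  intro σ X
  rw [symmetrise_apply, symmetrise_apply]
  congr 1
  exact Fintype.sum_equiv (Equiv.mulLeft σ) _ _ fun τ => rfl

theorem IsInvariant.symmetrise {n m : ℕ} {h : Tensor n m} (hh : IsInvariant h) :
    IsInvariant (symmetrise h) := by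
  intro Y X
  simp_rw [symmetrise_apply]
  rw [← Finset.mul_sum, Finset.sum_comm]
  refine mul_eq_zero_of_right _ (Finset.sum_eq_zero fun σ _ => ?_)
  rw [← hh Y (fun j => X (σ j))]
  refine (Fintype.sum_equiv σ _ _ fun s => ?_).symm
  congr 1
  ext1 j
  rw [show (fun j => X (σ j)) = X ∘ σ from rfl]
  by_cases hj : j = s
  · subst hj; simp
  · rw [Function.update_of_ne hj, Function.update_of_ne (by simpa using hj)]; rfl

theorem symmetrise_diag {n m : ℕ} (h : Tensor n m) (X : su n) :
    symmetrise h (fun _ => X) = h (fun _ => X) := by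
  rw [symmetrise_apply, Finset.sum_const, Finset.card_univ, Fintype.card_perm, Fintype.card_fin,
    nsmul_eq_mul, inv_mul_cancel_left₀ (by positivity)]

theorem symmetrise_mem {n m : ℕ} {h : Tensor n m} (hh : IsInvariant h) :
    symmetrise h ∈ invSymm n m :=
  ⟨hh.symmetrise, symmetrise_isSymm h⟩

theorem tensorMul_apply {n p q : ℕ} (f : Tensor n p) (g : Tensor n q) (X : Fin (p + q) → su n) :
    tensorMul f g X = f (fun i => X (Fin.castAdd q i)) * g (fun j => X (Fin.natAdd p j)) := by
  simp [tensorMul, MultilinearMap.domCoprod_apply]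

theorem IsInvariant.tensorMul {n p q : ℕ} {f : Tensor n p} {g : Tensor n q}
    (hf : IsInvariant f) (hg : IsInvariant g) : IsInvariant (tensorMul f g) := by
  intro Y X
  simp_rw [tensorMul_apply]
  rw [Fin.sum_univ_add]
  have h1 : ∀ (i : Fin p) (v : su n), (fun i' => Function.update X (Fin.castAdd q i) v
      (Fin.castAdd q i')) = Function.update (fun i' => X (Fin.castAdd q i')) i v := by
    intro i v
    ext1 i'
    by_cases h : i' = i
    · subst h; simp
    · rw [Function.update_of_ne h, Function.update_of_ne (by simpa using h)]
  have h2 : ∀ (i : Fin p) (v : su n), (fun j' => Function.update X (Fin.castAdd q i) v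
      (Fin.natAdd p j')) = (fun j' => X (Fin.natAdd p j')) := by
    intro i v
    ext1 j'
    rw [Function.update_of_ne]
    intro h
    have := congrArg Fin.val h
    simp at this
    omega
  have h3 : ∀ (j : Fin q) (v : su n), (fun j' => Function.update X (Fin.natAdd p j) v
      (Fin.natAdd p j')) = Function.update (fun j' => X (Fin.natAdd p j')) j v := by
    intro i v
    ext1 i'
    by_cases h : i' = i
    · subst h; simp
    · rw [Function.update_of_ne h, Function.update_of_ne (by simpa using h)]
  have h4 : ∀ (j : Fin q) (v : su n), (fun i' => Function.update X (Fin.natAdd p j) v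
      (Fin.castAdd q i')) = (fun i' => X (Fin.castAdd q i')) := by
    intro i v
    ext1 j'
    rw [Function.update_of_ne]
    intro h
    have := congrArg Fin.val h
    simp at this
    omega
  simp_rw [h1, h2, h3, h4]
  rw [← Finset.sum_mul, ← Finset.mul_sum, hf Y (fun i' => X (Fin.castAdd q i')),
    hg Y (fun i' => X (Fin.natAdd p i'))]
  simp

theorem symMul_mem {n p q : ℕ} {f : Tensor n p} {g : Tensor n q}
    (hf : f ∈ invSymm n p) (hg : g ∈ invSymm n q) : symMul f g ∈ invSymm n (p + q) :=
  symmetrise_mem (hf.1.tensorMul hg.1)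

theorem symMul_diag {n p q : ℕ} (f : Tensor n p) (g : Tensor n q) (X : su n) :
    symMul f g (fun _ => X) = f (fun _ => X) * g (fun _ => X) := by
  rw [symMul, symmetrise_diag, tensorMul_apply]

theorem castOrder_mem {n p m : ℕ} (e : p = m) {f : Tensor n p} (hf : f ∈ invSymm n p) :
    castOrder e f ∈ invSymm n m := by
  subst e
  exact hf

theorem castOrder_diag {n p m : ℕ} (e : p = m) (f : Tensor n p) (X : su n) :
    castOrder e f (fun _ => X) = f (fun _ => X) := rfl

/-! ### Symmetric traces -/

theorem sum_prod_update_commutator {R : Type*} [Ring R] (Y : R) :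
    ∀ {m : ℕ} (A : Fin m → R),
      ∑ s, (List.ofFn (Function.update A s (Y * A s - A s * Y))).prod =
        Y * (List.ofFn A).prod - (List.ofFn A).prod * Y := by
  intro m
  induction m with
  | zero => intro A; simp
  | succ m ih =>
    intro A
    rw [Fin.sum_univ_succ]
    have h1 : ∀ s : Fin m, (List.ofFn (Function.update A s.succ
        (Y * A s.succ - A s.succ * Y))).prod = A 0 *
        (List.ofFn (Function.update (fun i => A (Fin.succ i)) s
          (Y * A s.succ - A s.succ * Y))).prod := by
      intro s
      rw [List.ofFn_succ, List.prod_cons, Function.update_of_ne (Fin.succ_ne_zero s).symm]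
      congr 3
      ext1 i
      by_cases h : i = s
      · subst h; simp
      · rw [Function.update_of_ne h, Function.update_of_ne (by simpa using h)]
    simp_rw [h1]
    rw [← Finset.mul_sum, ih (fun i => A (Fin.succ i))]
    rw [List.ofFn_succ, List.prod_cons, List.ofFn_succ (f := A), List.prod_cons]
    simp only [Function.update_self, ne_eq, Fin.succ_ne_zero, not_false_eq_true,
      Function.update_of_ne]
    noncomm_ring

/-- The trace of the product of the hermitian matrices `Tⱼ = i Xⱼ`, before symmetrisation. -/
noncomputable def traceTensor (n m : ℕ) : Tensor n m :=
  (reTrace n).compMultilinearMap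
    ((MultilinearMap.mkPiAlgebraFin ℝ m (Matrix (Fin n) (Fin n) ℂ)).compLinearMap
      fun _ => herm n)

theorem traceTensor_apply (n m : ℕ) (X : Fin m → su n) :
    traceTensor n m X = (List.ofFn fun j => herm n (X j)).prod.trace.re := by
  simp [traceTensor, reTrace]

theorem herm_lie (n : ℕ) (Y X : su n) :
    herm n ⁅Y, X⁆ = (Y : Matrix (Fin n) (Fin n) ℂ) * herm n X - herm n X * Y := by
  simp [herm, Ring.lie_def, smul_sub]

/-- The commutator with `Y` is a derivation, so the sum over slots is the commutator of `Y` with the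
whole product, which has trace zero. -/
theorem traceTensor_isInvariant (n m : ℕ) : IsInvariant (traceTensor n m) := by
  intro Y X
  simp_rw [traceTensor_apply]
  rw [← Complex.re_sum, ← Matrix.trace_sum]
  have := sum_prod_update_commutator (Y : Matrix (Fin n) (Fin n) ℂ) (fun j => herm n (X j))
  simp_rw [← herm_lie] at this
  rw [show (∑ s, (List.ofFn fun j => herm n (Function.update X s ⁅Y, X s⁆ j)).prod) =
    (Y : Matrix (Fin n) (Fin n) ℂ) * (List.ofFn fun j => herm n (X j)).prod -
      (List.ofFn fun j => herm n (X j)).prod * Y from ?_]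
  · rw [Matrix.trace_sub, Matrix.trace_mul_comm, sub_self, Complex.zero_re]
  · rw [← this]
    refine Finset.sum_congr rfl fun s _ => ?_
    congr 2
    ext1 j
    by_cases h : j = s
    · subst h; simp
    · rw [Function.update_of_ne h, Function.update_of_ne h]

theorem k_mem (n m : ℕ) : k n m ∈ invSymm n m :=
  symmetrise_mem (traceTensor_isInvariant n m)

theorem k_diag (n m : ℕ) (X : su n) :
    k n m (fun _ => X) = ((herm n X) ^ m).trace.re := by
  have : k n m = symmetrise (traceTensor n m) := rfl
  rw [this, symmetrise_diag, traceTensor_apply]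
  simp

theorem kList_mem (n : ℕ) : ∀ L : List ℕ, kList n L ∈ invSymm n L.sum
  | [] => ⟨fun _ _ => Finset.sum_of_isEmpty (ι := Fin 0) _, fun _ _ => rfl⟩
  | m :: L => symMul_mem (k_mem n m) (kList_mem n L)

theorem kList_diag (n : ℕ) (X : su n) : ∀ L : List ℕ,
    kList n L (fun _ => X) = (L.map fun p => k n p (fun _ => X)).prod
  | [] => rfl
  | m :: L => by
    rw [List.map_cons, List.prod_cons, ← kList_diag n X L]
    exact symMul_diag _ _ X

theorem kPart_mem (n : ℕ) {m : ℕ} (μ : m.Partition) : kPart n μ ∈ invSymm n m :=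
  castOrder_mem _ (kList_mem n _)

theorem kPart_diag (n : ℕ) {m : ℕ} (μ : m.Partition) (X : su n) :
    kPart n μ (fun _ => X) = (μ.parts.map fun p => k n p (fun _ => X)).prod := by
  rw [kPart, castOrder_diag, kList_diag, ← Multiset.prod_coe, ← Multiset.map_coe,
    Multiset.sort_eq]

theorem herm_conjTranspose {n : ℕ} (X : su n) : (herm n X).conjTranspose = herm n X := by
  have : (X : Matrix (Fin n) (Fin n) ℂ).conjTranspose = -X := X.2.1
  simp [herm, Matrix.conjTranspose_smul, this]

theorem k_apply (n m : ℕ) (X : Fin m → su n) :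
    k n m X = (m ! : ℝ)⁻¹ * ∑ σ : Equiv.Perm (Fin m),
      (List.ofFn fun j => herm n (X (σ j))).prod.trace.re := by
  have : k n m = symmetrise (traceTensor n m) := rfl
  rw [this, symmetrise_apply]
  simp_rw [traceTensor_apply]

theorem star_trace_prod_ofFn {n : ℕ} : ∀ {m : ℕ} (A : Fin m → Matrix (Fin n) (Fin n) ℂ),
    (∀ j, (A j).conjTranspose = A j) →
    (List.ofFn A).prod.conjTranspose = (List.ofFn fun j => A (Fin.rev j)).prod := by
  intro m A hA
  rw [Matrix.conjTranspose_list_prod]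
  congr 1
  refine List.ext_getElem (by simp) fun i h1 h2 => ?_
  simp only [List.length_ofFn] at h2
  simp only [List.getElem_reverse, List.length_map, List.length_ofFn, List.getElem_map,
    List.getElem_ofFn, hA]
  congr 1
  ext
  simp
  omega

theorem symTrace_eq {n m : ℕ} (X : Fin m → su n) :
    symTrace (fun j => (X j : Matrix (Fin n) (Fin n) ℂ)) =
      (-Complex.I) ^ m * (k n m X : ℂ) := by
  have h1 : ∀ j, (X j : Matrix (Fin n) (Fin n) ℂ) = (-Complex.I) • herm n (X j) := by
    intro j
    simp [herm, smul_smul]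
  have h2 : ∀ {m : ℕ} (c : ℂ) (A : Fin m → Matrix (Fin n) (Fin n) ℂ),
      (List.ofFn fun j => c • A j).prod = c ^ m • (List.ofFn A).prod := by
    intro m c
    induction m with
    | zero => intro A; simp
    | succ m ih =>
      intro A
      rw [List.ofFn_succ, List.prod_cons, ih fun i => A i.succ, List.ofFn_succ, List.prod_cons,
        smul_mul_smul_comm, pow_succ']
  -- Complex conjugation of the trace reverses a product of hermitian matrices, and the reversal is
  -- absorbed into the sum over permutations.
  have hreal : ((∑ σ : Equiv.Perm (Fin m),
      (List.ofFn fun j => herm n (X (σ j))).prod.trace.re : ℝ) : ℂ) =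
      ∑ σ : Equiv.Perm (Fin m), (List.ofFn fun j => herm n (X (σ j))).prod.trace := by
    rw [← Complex.re_sum]
    refine Complex.conj_eq_iff_re.mp ?_
    rw [map_sum]
    refine Fintype.sum_equiv (Equiv.mulRight Fin.revPerm) _ _ fun σ => ?_
    rw [starRingEnd_apply, ← Matrix.trace_conjTranspose,
      star_trace_prod_ofFn _ fun j => herm_conjTranspose _]
    rfl
  rw [symTrace, k_apply]
  simp_rw [h1]
  have h3 := fun σ : Equiv.Perm (Fin m) => h2 (-Complex.I) (fun j => herm n (X (σ j)))
  simp_rw [h3, Matrix.trace_smul, ← Finset.smul_sum]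
  push_cast at hreal ⊢
  rw [hreal, smul_eq_mul]
  ring

/-! ### The antisymmetrised contraction -/

/-- The contraction with a single matrix is a sum of principal minors over all sequences of
indices. -/
theorem antisymTrace_const {n : ℕ} (m : ℕ) (A : Matrix (Fin n) (Fin n) ℂ) :
    antisymTrace (fun _ : Fin m => A) = ∑ α : Fin m → Fin n, ∑ σ : Equiv.Perm (Fin m),
      ((Equiv.Perm.sign σ : ℤ) : ℂ) * ∏ j, A (α (σ j)) (α j) := by
  rw [antisymTrace, Finset.sum_comm]
  refine Finset.sum_congr rfl fun β _ => ?_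
  simp_rw [eps]
  push_cast
  simp_rw [Finset.sum_mul]
  rw [Finset.sum_comm]
  refine Finset.sum_congr rfl fun σ _ => ?_
  simp_rw [mul_assoc]
  rw [← Finset.mul_sum, Fintype.sum_eq_single (fun j => β (σ j))]
  · simp
  · intro α hα
    obtain ⟨j, hj⟩ := Function.ne_iff.mp hα
    rw [Finset.prod_eq_zero (Finset.mem_univ j) (by simp [hj]), zero_mul]

/-- This makes the contraction of a single matrix invariant under conjugation, hence a function of
the eigenvalues. Inserting the intermediate indices `γ` and relabelling `α` by `σ` exchanges the
roles of `P` and `Q`. -/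
theorem antisymTrace_mul_comm {n : ℕ} (m : ℕ) (P Q : Matrix (Fin n) (Fin n) ℂ) :
    antisymTrace (fun _ : Fin m => P * Q) = antisymTrace (fun _ : Fin m => Q * P) := by
  have key : ∀ P Q : Matrix (Fin n) (Fin n) ℂ, antisymTrace (fun _ : Fin m => P * Q) =
      ∑ α : Fin m → Fin n, ∑ σ : Equiv.Perm (Fin m), ∑ γ : Fin m → Fin n,
        ((Equiv.Perm.sign σ : ℤ) : ℂ) * ((∏ j, P (α (σ j)) (γ j)) * ∏ j, Q (γ j) (α j)) := by
    intro P Q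
    rw [antisymTrace_const]
    refine Finset.sum_congr rfl fun α _ => Finset.sum_congr rfl fun σ _ => ?_
    simp_rw [Matrix.mul_apply]
    rw [← Finset.mul_sum, Fintype.prod_sum]
    simp_rw [Finset.prod_mul_distrib]
  rw [key, key]
  simp_rw [fun α : Fin m → Fin n => Finset.sum_comm (s := (Finset.univ : Finset (Equiv.Perm (Fin m))))
    (t := (Finset.univ : Finset (Fin m → Fin n)))
    (f := fun σ γ => ((Equiv.Perm.sign σ : ℤ) : ℂ) *
      ((∏ j, P (α (σ j)) (γ j)) * ∏ j, Q (γ j) (α j)))]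
  rw [Finset.sum_comm]
  refine Finset.sum_congr rfl fun γ _ => ?_
  rw [Finset.sum_comm]
  refine Finset.sum_congr rfl fun σ _ => ?_
  refine Fintype.sum_equiv (Equiv.arrowCongr σ.symm (Equiv.refl _)) _ _ fun α => ?_
  simp only [Equiv.arrowCongr_apply, Equiv.coe_refl, Function.comp, id, Equiv.symm_symm]
  rw [mul_comm (∏ j, P _ _), ← Equiv.prod_comp σ fun j => Q (γ j) (α j)]

/-- Antisymmetrising `n × n` matrices over more than `n` indices gives zero. -/
theorem antisymTrace_eq_zero {n m : ℕ} (h : n < m) (A : Fin m → Matrix (Fin n) (Fin n) ℂ) :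
    antisymTrace A = 0 := by
  refine Finset.sum_eq_zero fun α _ => Finset.sum_eq_zero fun β _ => ?_
  -- Pigeonhole: two upper indices agree, so `eps α β`, being a determinant, has two equal columns.
  obtain ⟨i, j, hij, hα⟩ := Fintype.exists_ne_map_eq_of_card_lt α (by simpa using h)
  have h1 : eps α β = (Matrix.of fun a b => if α b = β a then (1 : ℤ) else 0).det := by
    rw [Matrix.det_apply', eps]
    rfl
  rw [h1, Matrix.det_zero_of_column_eq hij (fun a => by simp [hα])]
  simp

/-- The sum over `σ` is a minor of a diagonal matrix: it has equal rows if `α` repeats an index, and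
is the product of the `x (α j)` otherwise. Each `m`-subset of indices is enumerated by `m!`
injective sequences. -/
theorem antisymTrace_diagonal {n : ℕ} (m : ℕ) (x : Fin n → ℂ) :
    antisymTrace (fun _ : Fin m => Matrix.diagonal x) =
      (m ! : ℂ) * MvPolynomial.aeval x (MvPolynomial.esymm (Fin n) ℂ m) := by
  classical
  rw [antisymTrace_const]
  have h1 : ∀ α : Fin m → Fin n, (∑ σ : Equiv.Perm (Fin m), ((Equiv.Perm.sign σ : ℤ) : ℂ) *
      ∏ j, Matrix.diagonal x (α (σ j)) (α j)) =
      if Function.Injective α then ∏ j, x (α j) else 0 := by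
    intro α
    have h2 := Matrix.det_apply' (Matrix.of fun a b => Matrix.diagonal x (α a) (α b))
    simp only [Matrix.of_apply] at h2
    rw [← h2]
    split_ifs with hα
    · rw [← Matrix.det_diagonal]
      congr 1
      ext a b
      by_cases hab : a = b
      · subst hab; simp
      · simp [hab, hα.ne hab]
    · simp only [Function.Injective, not_forall] at hα
      obtain ⟨i, j, hα, hij⟩ := hα
      exact Matrix.det_zero_of_row_eq hij (by ext b; simp [hα])
  simp_rw [h1]
  rw [← Finset.sum_filter, MvPolynomial.esymm, map_sum]
  rw [← Finset.sum_fiberwise_of_maps_to (t := Finset.powersetCard m Finset.univ)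
    (g := fun α => Finset.univ.image α), Finset.mul_sum]
  · refine Finset.sum_congr rfl fun S hS => ?_
    have hS' := (Finset.mem_powersetCard.mp hS).2
    rw [Finset.sum_congr rfl (g := fun _ => ∏ i ∈ S, x i)]
    · rw [Finset.sum_const, nsmul_eq_mul, map_prod]
      simp only [MvPolynomial.aeval_X]
      congr 2
      have e : {α // α ∈ ((Finset.univ : Finset (Fin m → Fin n)).filter
          Function.Injective).filter (fun α => Finset.univ.image α = S)} ≃ (Fin m ≃ S) :=
        { toFun := fun α => Equiv.ofBijective
            (fun j => ⟨α.1 j, by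
              exact (Finset.ext_iff.mp (Finset.mem_filter.mp α.2).2 _).mp
                (Finset.mem_image_of_mem _ (Finset.mem_univ j))⟩) (by
              have h3 := (Finset.mem_filter.mp α.2)
              have h4 := (Finset.mem_filter.mp h3.1).2
              refine ⟨fun a b hab => h4 (congrArg Subtype.val hab), fun s => ?_⟩
              obtain ⟨j, -, hj⟩ := Finset.mem_image.mp ((Finset.ext_iff.mp h3.2 _).mpr s.2)
              exact ⟨j, Subtype.ext hj⟩)
          invFun := fun f => ⟨fun j => (f j : Fin n), by
            refine Finset.mem_filter.mpr ⟨Finset.mem_filter.mpr ⟨Finset.mem_univ _, ?_⟩, ?_⟩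
            · exact fun a b hab => f.injective (Subtype.ext hab)
            · ext i
              simp only [Finset.mem_image, Finset.mem_univ, true_and]
              exact ⟨fun ⟨j, hj⟩ => hj ▸ (f j).2, fun hi => ⟨f.symm ⟨i, hi⟩, by simp⟩⟩⟩
          left_inv := fun α => rfl
          right_inv := fun f => by ext; rfl }
      rw [← Fintype.card_coe, Fintype.card_congr e,
        Fintype.card_equiv (Fintype.equivOfCardEq (by simp [hS'])), Fintype.card_fin]
    · intro α hα
      have h3 := Finset.mem_filter.mp hα
      have h4 := (Finset.mem_filter.mp h3.1).2
      rw [← h3.2, Finset.prod_image (fun a _ b _ hab => h4 hab)]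
  · intro α hα
    rw [Finset.mem_powersetCard]
    refine ⟨Finset.subset_univ _, ?_⟩
    rw [Finset.card_image_of_injective _ (Finset.mem_filter.mp hα).2, Finset.card_univ,
      Fintype.card_fin]

/-! ### Restriction to the Cartan subalgebra -/

/-- The diagonal matrices in `su n`. -/
def cartan (n : ℕ) : Submodule ℝ (su n) where
  carrier := {X | (X : Matrix (Fin n) (Fin n) ℂ).IsDiag}
  add_mem' hX hY := Matrix.IsDiag.add hX hY
  zero_mem' := Matrix.isDiag_zero
  smul_mem' c _ hX := Matrix.IsDiag.smul c hX

theorem su_apply_swap {n : ℕ} (X : su n) (i j : Fin n) :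
    star ((X : Matrix (Fin n) (Fin n) ℂ) i j) = -(X : Matrix (Fin n) (Fin n) ℂ) j i :=
  congrFun (congrFun X.2.1 j) i

/-- A matrix with vanishing diagonal is a commutator with any regular diagonal matrix. -/
theorem exists_lie_eq {n : ℕ} {D : su n} (hD : D ∈ cartan n)
    (hreg : Function.Injective fun i => (D : Matrix (Fin n) (Fin n) ℂ) i i)
    {W : su n} (hW : ∀ i, (W : Matrix (Fin n) (Fin n) ℂ) i i = 0) : ∃ Y : su n, ⁅Y, D⁆ = W := by
  set d : Fin n → ℂ := fun i => (D : Matrix (Fin n) (Fin n) ℂ) i i with hd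
  have hDd : (D : Matrix (Fin n) (Fin n) ℂ) = Matrix.diagonal d := (Matrix.IsDiag.diagonal_diag hD).symm
  have hY : (Matrix.of fun i j => (W : Matrix (Fin n) (Fin n) ℂ) i j / (d j - d i)) ∈ su n := by
    refine ⟨?_, by simp [Matrix.trace, hW]⟩
    ext i j
    have h1 := su_apply_swap W j i
    have h2 := su_apply_swap D i i
    have h3 := su_apply_swap D j j
    simp only [Matrix.conjTranspose_apply, Matrix.of_apply, Matrix.neg_apply, star_div₀, star_sub,
      hd, h1, h2, h3]
    rw [neg_div, neg_sub_neg]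
  refine ⟨⟨_, hY⟩, ?_⟩
  ext i j
  rw [LieSubalgebra.coe_bracket, Ring.lie_def, hDd, Matrix.sub_apply, Matrix.mul_diagonal,
    Matrix.diagonal_mul, mul_comm (d i), ← mul_sub]
  change (W : Matrix (Fin n) (Fin n) ℂ) i j / (d j - d i) * (d j - d i) = _
  by_cases hij : i = j
  · subst hij; simp [hW]
  · exact div_mul_cancel₀ _ (sub_ne_zero.mpr fun h => hij (hreg h).symm)

/-- Along a line the map is a polynomial in `ε`, so no topology on `E` is needed. -/
theorem continuous_multilinear_line {ι E : Type*} [Fintype ι] [AddCommGroup E] [Module ℝ E]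
    (f : MultilinearMap ℝ (fun _ : ι => E) ℝ) (x y : ι → E) :
    Continuous fun ε : ℝ => f (fun j => x j + ε • y j) := by
  classical
  have h1 : ∀ ε : ℝ, f (fun j => x j + ε • y j) = ∑ r : ι → Bool,
      (∏ j, (if r j then (1 : ℝ) else ε)) • f (fun j => if r j then x j else y j) := by
    intro ε
    rw [show (fun j => x j + ε • y j) = fun j => ∑ b : Bool,
      (if b then (1 : ℝ) else ε) • (if b then x j else y j) by ext1 j; simp, f.map_sum]
    refine Finset.sum_congr rfl fun r _ => ?_
    rw [← f.map_smul_univ]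
  simp_rw [h1]
  have h2 : ∀ (r : ι → Bool) (j : ι), Continuous fun ε : ℝ => if r j then (1 : ℝ) else ε := by
    intro r j
    split_ifs <;> fun_prop
  fun_prop

/-- The curve stays in the span of finitely many vectors, so the value is a polynomial in its real
coefficients and the product rule applies, again without a topology on `E`. -/
theorem hasDerivAt_multilinear_diag {ι κ E : Type*} [Fintype ι] [DecidableEq ι] [Fintype κ]
    [AddCommGroup E] [Module ℝ E]
    (f : MultilinearMap ℝ (fun _ : ι => E) ℝ) (V : κ → E) (c : ℝ → κ → ℝ) (c' : κ → ℝ) (t : ℝ)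
    (hc : ∀ a, HasDerivAt (fun s => c s a) (c' a) t) :
    HasDerivAt (fun s => f (fun _ => ∑ a, c s a • V a))
      (∑ j, f (Function.update (fun _ => ∑ a, c t a • V a) j (∑ a, c' a • V a))) t := by
  classical
  have h1 : ∀ s, f (fun _ => ∑ a, c s a • V a) = ∑ r : ι → κ,
      (∏ j, c s (r j)) * f (fun j => V (r j)) := by
    intro s
    rw [f.map_sum (fun _ a => c s a • V a)]
    refine Finset.sum_congr rfl fun r _ => ?_
    rw [← smul_eq_mul, ← f.map_smul_univ]
  have h2 : ∀ j, f (Function.update (fun _ => ∑ a, c t a • V a) j (∑ a, c' a • V a)) =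
      ∑ r : ι → κ, ((∏ i ∈ Finset.univ.erase j, c t (r i)) • c' (r j)) *
        f (fun j => V (r j)) := by
    intro j
    rw [show Function.update (fun _ => ∑ a, c t a • V a) j (∑ a, c' a • V a) =
      fun i => ∑ a, (if i = j then c' a else c t a) • V a from ?_, f.map_sum]
    · refine Finset.sum_congr rfl fun r _ => ?_
      rw [f.map_smul_univ (fun i => if i = j then c' (r i) else c t (r i)) (fun i => V (r i)),
        ← Finset.prod_erase_mul _ _ (Finset.mem_univ j), if_pos rfl, smul_eq_mul, smul_eq_mul]
      congr 2
      refine Finset.prod_congr rfl fun i hi => ?_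
      rw [if_neg (Finset.ne_of_mem_erase hi)]
    · ext1 i
      by_cases h : i = j
      · subst h; simp
      · simp [h]
  simp_rw [h1, h2]
  rw [Finset.sum_comm]
  refine HasDerivAt.fun_sum fun r _ => ?_
  rw [← Finset.sum_mul]
  exact (HasDerivAt.fun_finsetProd fun j _ => hc (r j)).mul_const _

/-- Invariance under a one-parameter group of rotations. -/
theorem IsInvariant.rotation {n m : ℕ} {h : Tensor n m} (hh : IsInvariant h) {Y V₀ V₁ V₂ : su n}
    (h₀ : ⁅Y, V₀⁆ = 0) (h₁ : ⁅Y, V₁⁆ = V₂) (h₂ : ⁅Y, V₂⁆ = -V₁) :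
    h (fun _ => V₀ + V₁) = h (fun _ => V₀ - V₁) := by
  -- The curve `V₀ + cos s V₁ + sin s V₂` is an orbit of the flow of `ad Y`, so its velocity is its
  -- bracket with `Y` and invariance says that the derivative is zero. The times `0` and `π` give
  -- the two sides.
  have hd : ∀ t, HasDerivAt (fun s => h (fun _ => ∑ a : Fin 3,
      (![1, Real.cos s, Real.sin s] : Fin 3 → ℝ) a • (![V₀, V₁, V₂] : Fin 3 → su n) a)) 0 t := by
    intro t
    have := hasDerivAt_multilinear_diag h (![V₀, V₁, V₂] : Fin 3 → su n)
      (fun s => ![1, Real.cos s, Real.sin s]) ![0, -Real.sin t, Real.cos t] t (by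
        intro a
        fin_cases a
        · exact hasDerivAt_const t 1
        · exact Real.hasDerivAt_cos t
        · exact Real.hasDerivAt_sin t)
    convert this using 1
    refine (hh Y (fun _ => ∑ a : Fin 3, (![1, Real.cos t, Real.sin t] : Fin 3 → ℝ) a •
      (![V₀, V₁, V₂] : Fin 3 → su n) a)).symm.trans ?_
    refine Finset.sum_congr rfl fun j _ => ?_
    congr 2
    simp [Fin.sum_univ_three, h₀, h₁, h₂, add_comm]
  have h3 := is_const_of_deriv_eq_zero (fun t => (hd t).differentiableAt) (fun t => (hd t).deriv)
    0 Real.pi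
  simpa [Fin.sum_univ_three, sub_eq_add_neg] using h3

/-- The diagonal element of `su n` whose hermitian matrix is the traceless part of
`diagonal x`. -/
noncomputable def diagEl (n : ℕ) : (Fin n → ℝ) →ₗ[ℝ] su n where
  toFun x := ⟨Matrix.diagonal fun i => -Complex.I * ((x i - (∑ j, x j) / n : ℝ) : ℂ), by
    refine ⟨?_, ?_⟩
    · rw [Matrix.diagonal_conjTranspose, Matrix.diagonal_neg]
      congr 1
      ext i
      simp
    · rcases Nat.eq_zero_or_pos n with rfl | hn
      · simp [Matrix.trace]
      · rw [Matrix.trace_diagonal, ← Finset.mul_sum, ← Complex.ofReal_sum, Finset.sum_sub_distrib,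
          Finset.sum_const, Finset.card_univ, Fintype.card_fin, nsmul_eq_mul,
          mul_div_cancel₀ _ (by positivity), sub_self, Complex.ofReal_zero, mul_zero]⟩
  map_add' x y := by
    ext1
    change Matrix.diagonal _ = Matrix.diagonal _ + Matrix.diagonal _
    rw [Matrix.diagonal_add]
    congr 1
    ext i
    simp only [Pi.add_apply, Finset.sum_add_distrib]
    push_cast
    ring
  map_smul' c x := by
    ext1
    change Matrix.diagonal _ = c • Matrix.diagonal _
    rw [← Matrix.diagonal_smul]
    congr 1
    ext i
    simp only [Pi.smul_apply, smul_eq_mul, ← Finset.mul_sum, Complex.real_smul]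
    push_cast
    ring

theorem diagEl_coe (n : ℕ) (x : Fin n → ℝ) : (diagEl n x : Matrix (Fin n) (Fin n) ℂ) =
    Matrix.diagonal fun i => -Complex.I * ((x i - (∑ j, x j) / n : ℝ) : ℂ) := rfl

theorem diagEl_mem_cartan (n : ℕ) (x : Fin n → ℝ) : diagEl n x ∈ cartan n :=
  Matrix.isDiag_diagonal _

theorem herm_diagEl (n : ℕ) (x : Fin n → ℝ) : herm n (diagEl n x) =
    Matrix.diagonal fun i => ((x i - (∑ j, x j) / n : ℝ) : ℂ) := by
  change Complex.I • (diagEl n x : Matrix (Fin n) (Fin n) ℂ) = _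
  rw [diagEl_coe, ← Matrix.diagonal_smul]
  congr 1
  ext i
  rw [Pi.smul_apply, smul_eq_mul, ← mul_assoc, mul_neg, Complex.I_mul_I, neg_neg, one_mul]

theorem k_diagEl (n p : ℕ) (x : Fin n → ℝ) :
    k n p (fun _ => diagEl n x) = ∑ i, (x i - (∑ j, x j) / n) ^ p := by
  rw [k_diag, herm_diagEl, Matrix.diagonal_pow, Matrix.trace_diagonal, Complex.re_sum]
  refine Finset.sum_congr rfl fun i _ => ?_
  rw [Pi.pow_apply, ← Complex.ofReal_pow, Complex.ofReal_re]

theorem exists_diagEl_eq {n : ℕ} {X : su n} (hX : X ∈ cartan n) : ∃ x, diagEl n x = X := by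
  refine ⟨fun i => (Complex.I * (X : Matrix (Fin n) (Fin n) ℂ) i i).re, ?_⟩
  have h1 : ∀ i, (((Complex.I * (X : Matrix (Fin n) (Fin n) ℂ) i i).re : ℝ) : ℂ) =
      Complex.I * (X : Matrix (Fin n) (Fin n) ℂ) i i := by
    intro i
    refine Complex.conj_eq_iff_re.mp ?_
    have := su_apply_swap X i i
    rw [map_mul, Complex.conj_I, starRingEnd_apply, this, neg_mul_neg]
  have h2 : (∑ i, (Complex.I * (X : Matrix (Fin n) (Fin n) ℂ) i i).re) = 0 := by
    rw [← Complex.re_sum, ← Finset.mul_sum]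
    have : ∑ i, (X : Matrix (Fin n) (Fin n) ℂ) i i = 0 := X.2.2
    simp [this]
  ext1
  rw [diagEl_coe, h2]
  simp only [zero_div, sub_zero, h1, ← mul_assoc, neg_mul, Complex.I_mul_I, neg_neg, one_mul]
  exact Matrix.IsDiag.diagonal_diag hX

theorem exists_regular (n : ℕ) : ∃ R ∈ cartan n,
    Function.Injective fun i => (R : Matrix (Fin n) (Fin n) ℂ) i i := by
  refine ⟨diagEl n fun i => (i : ℝ), diagEl_mem_cartan _ _, fun i j h => ?_⟩
  simp only [diagEl_coe, Matrix.diagonal_apply_eq] at h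
  have h1 := mul_left_cancel₀ (neg_ne_zero.mpr Complex.I_ne_zero) h
  have h2 := sub_left_injective (Complex.ofReal_injective h1)
  exact Fin.ext (by exact_mod_cast h2)

theorem exists_cartan_add (n : ℕ) (X : su n) : ∃ D ∈ cartan n, ∃ W : su n,
    (∀ i, (W : Matrix (Fin n) (Fin n) ℂ) i i = 0) ∧ X = D + W := by
  have hD : (Matrix.diagonal fun i => (X : Matrix (Fin n) (Fin n) ℂ) i i) ∈ su n := by
    refine ⟨?_, ?_⟩
    · rw [Matrix.diagonal_conjTranspose, Matrix.diagonal_neg]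
      congr 1
      ext i
      exact su_apply_swap X i i
    · rw [Matrix.trace_diagonal]
      exact X.2.2
  refine ⟨⟨_, hD⟩, Matrix.isDiag_diagonal _, X - ⟨_, hD⟩, fun i => ?_, by abel⟩
  change (X : Matrix (Fin n) (Fin n) ℂ) i i - Matrix.diagonal _ i i = 0
  rw [Matrix.diagonal_apply_eq, sub_self]

/-- An invariant tensor vanishes if its restriction to the Cartan subalgebra does. -/
theorem eq_zero_of_cartan {n m : ℕ} {h : Tensor n m} (hh : h ∈ invSymm n m)
    (h0 : ∀ D ∈ cartan n, h (fun _ => D) = 0) : h = 0 := by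
  obtain ⟨hinv, hsymm⟩ := hh
  -- Induction on a set `S` of slots outside which all arguments are diagonal: for `S = ∅` this is
  -- the hypothesis, polarised.
  suffices H : ∀ (S : Finset (Fin m)) (X : Fin m → su n), (∀ s ∉ S, X s ∈ cartan n) → h X = 0 by
    ext X
    exact H Finset.univ X fun s hs => absurd (Finset.mem_univ s) hs
  intro S
  induction S using Finset.induction_on with
  | empty =>
    intro X hX
    have h1 := multilinear_eq_zero_of_diag (h.compLinearMap fun _ => (cartan n).subtype)
      (fun σ v => hsymm σ fun j => (v j : su n)) (fun x => h0 x x.2)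
    have h2 := congrFun (congrArg DFunLike.coe h1) fun s => ⟨X s, hX s (Finset.notMem_empty s)⟩
    simpa using h2
  | insert a S ha ih =>
    intro X hX
    obtain ⟨T, hT, W, hW, hTW⟩ := exists_cartan_add n (X a)
    have hX' : X = Function.update X a (T + W) := by rw [← hTW, Function.update_eq_self]
    rw [hX', h.map_update_add]
    have hT0 : h (Function.update X a T) = 0 := by
      refine ih _ fun s hs => ?_
      by_cases hsa : s = a
      · subst hsa; simpa using hT
      · rw [Function.update_of_ne hsa]
        exact hX s (by simp [hsa, hs])
    rw [hT0, zero_add]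
    -- `Z D` has `D` in the slots outside `S`
    let Z : su n → Fin m → su n := fun D s => if s ∈ S then X s else D
    -- For regular `D` write `W = [Y, D]` and apply invariance under `Y` to `Z D`. The terms from
    -- slots in `S` vanish by induction; those from the other slots are all equal by symmetry, and
    -- there is at least one, at `a`.
    have hreg : ∀ D ∈ cartan n, (Function.Injective fun i => (D : Matrix (Fin n) (Fin n) ℂ) i i) →
        h (Function.update (Z D) a W) = 0 := by
      intro D hD hDreg
      obtain ⟨Y, hY⟩ := exists_lie_eq hD hDreg hW
      have h1 := hinv Y (Z D)
      have h2 : ∀ s, h (Function.update (Z D) s ⁅Y, Z D s⁆) =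
          if s ∈ S then 0 else h (Function.update (Z D) a W) := by
        intro s
        split_ifs with hs
        · refine ih _ fun t ht => ?_
          have hts : t ≠ s := fun hts => ht (hts ▸ hs)
          rw [Function.update_of_ne hts]
          simpa [Z, ht] using hD
        · have h3 : Z D s = D := by simp [Z, hs]
          rw [h3, hY, ← hsymm (Equiv.swap a s)]
          congr 1
          ext1 t
          by_cases hta : t = a
          · subst hta; simp
          · by_cases hts : t = s
            · subst hts
              rw [Equiv.swap_apply_right, Function.update_of_ne hta,
                Function.update_of_ne (Ne.symm hta)]
              simp [Z, hs, ha]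
            · rw [Equiv.swap_apply_of_ne_of_ne hta hts, Function.update_of_ne hta,
                Function.update_of_ne hts]
      simp_rw [h2] at h1
      rw [Finset.sum_ite, Finset.sum_const_zero, zero_add, Finset.sum_const, smul_eq_zero] at h1
      refine h1.resolve_left fun h3 => ?_
      rw [Finset.card_eq_zero] at h3
      exact Finset.notMem_empty a (h3 ▸ (by simp [ha]))
    -- Regularity is removed by density: for a fixed regular `R`, `D + εR` is regular for all but
    -- finitely many `ε`.
    have hall : ∀ D ∈ cartan n, h (Function.update (Z D) a W) = 0 := by
      intro D hD
      obtain ⟨R, hR, hRreg⟩ := exists_regular n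
      have hcont := continuous_multilinear_line h (Function.update (Z D) a W)
        (fun s => if s = a ∨ s ∈ S then 0 else R)
      have hline : ∀ ε : ℝ, (fun j => Function.update (Z D) a W j + ε •
          (if j = a ∨ j ∈ S then 0 else R)) = Function.update (Z (D + ε • R)) a W := by
        intro ε
        ext1 j
        by_cases hja : j = a
        · subst hja; simp
        · by_cases hjS : j ∈ S <;> simp [Z, hja, hjS]
      simp_rw [hline] at hcont
      have hfin : {ε : ℝ | ¬ Function.Injective fun i =>
          ((D + ε • R : su n) : Matrix (Fin n) (Fin n) ℂ) i i}.Finite := by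
        refine Set.Finite.subset (Set.finite_iUnion fun p : {p : Fin n × Fin n // p.1 ≠ p.2} =>
          Set.Subsingleton.finite (s := {ε : ℝ |
            ((D + ε • R : su n) : Matrix (Fin n) (Fin n) ℂ) p.1.1 p.1.1 =
            ((D + ε • R : su n) : Matrix (Fin n) (Fin n) ℂ) p.1.2 p.1.2}) ?_) ?_
        · intro ε hε δ hδ
          have hne := hRreg.ne p.2
          simp only [Set.mem_ofPred_eq] at hε hδ
          have e1 : ∀ (c : ℝ) i, ((D + c • R : su n) : Matrix (Fin n) (Fin n) ℂ) i i =
            (D : Matrix (Fin n) (Fin n) ℂ) i i + c * (R : Matrix (Fin n) (Fin n) ℂ) i i :=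
            fun c i => rfl
          rw [e1, e1] at hε hδ
          have e2 : ((ε : ℂ) - δ) * ((R : Matrix (Fin n) (Fin n) ℂ) p.1.1 p.1.1 -
            (R : Matrix (Fin n) (Fin n) ℂ) p.1.2 p.1.2) = 0 := by linear_combination hε - hδ
          have e3 := (mul_eq_zero.mp e2).resolve_right (sub_ne_zero.mpr hne)
          exact_mod_cast sub_eq_zero.mp e3
        · intro ε hε
          simp only [Set.mem_ofPred_eq, Function.Injective, not_forall] at hε
          obtain ⟨i, j, hij, hne⟩ := hε
          exact Set.mem_iUnion.mpr ⟨⟨(i, j), hne⟩, hij⟩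
      have hdense : Dense {ε : ℝ | ¬ Function.Injective fun i =>
          ((D + ε • R : su n) : Matrix (Fin n) (Fin n) ℂ) i i}ᶜ := hfin.countable.dense_compl ℝ
      have h4 := Continuous.ext_on hdense hcont (continuous_const (y := (0 : ℝ))) fun ε hε =>
        hreg _ ((cartan n).add_mem hD ((cartan n).smul_mem ε hR)) (not_not.mp hε)
      simpa using congrFun h4 0
    -- So far the slots outside `S` and `a` carry the same `D`; polarising in these slots alone
    -- allows arbitrary diagonal entries.
    let P : Fin m → Prop := fun s => ¬ (s = a ∨ s ∈ S)
    let z : Fin m → su n := Function.update X a W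
    have h5 := multilinear_eq_zero_of_diag
      ((h.domDomRestrict P fun s => z s).compLinearMap fun _ => (cartan n).subtype)
      (fun σ v => by
        simp only [MultilinearMap.compLinearMap_apply, MultilinearMap.domDomRestrict_apply]
        refine (congrArg h ?_).trans (hsymm (Equiv.Perm.ofSubtype σ) _)
        ext1 j
        by_cases hj : P j
        · have hσ := Equiv.Perm.ofSubtype_apply_of_mem σ hj
          have hP : P (Equiv.Perm.ofSubtype σ j) := hσ ▸ (σ ⟨j, hj⟩).2
          rw [dif_pos hj, dif_pos hP]
          congr 2
          exact Subtype.ext hσ.symm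
        · rw [Equiv.Perm.ofSubtype_apply_of_not_mem σ hj, dif_neg hj, dif_neg hj])
      (fun D => by
        simp only [MultilinearMap.compLinearMap_apply, MultilinearMap.domDomRestrict_apply]
        rw [← hall D D.2]
        congr 1
        ext1 j
        by_cases hja : j = a
        · subst hja; simp [P, z]
        · by_cases hjS : j ∈ S <;> simp [P, Z, z, hja, hjS])
    have h6 := congrFun (congrArg DFunLike.coe h5) fun s => ⟨X s, hX s (by simpa [P] using s.2)⟩
    simp only [MultilinearMap.compLinearMap_apply, MultilinearMap.domDomRestrict_apply,
      zero_apply] at h6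
    rw [← h6]
    congr 1
    ext1 j
    by_cases hja : j = a
    · subst hja; simp [P, z]
    · by_cases hjS : j ∈ S <;> simp [P, z, hja, hjS]

/-! ### Symmetry of the restricted polynomial under permutations -/

theorem lie_coe_diagonal {n : ℕ} (Y : su n) (D : su n) (d : Fin n → ℂ)
    (hD : (D : Matrix (Fin n) (Fin n) ℂ) = Matrix.diagonal d) (a b : Fin n) :
    ((⁅Y, D⁆ : su n) : Matrix (Fin n) (Fin n) ℂ) a b =
      (Y : Matrix (Fin n) (Fin n) ℂ) a b * (d b - d a) := by
  rw [LieSubalgebra.coe_bracket, Ring.lie_def, hD, Matrix.sub_apply, Matrix.mul_diagonal,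
    Matrix.diagonal_mul, mul_comm (d a), ← mul_sub]

/-- The restriction of an invariant to the Cartan subalgebra is symmetric under
transpositions. -/
theorem IsInvariant.diagEl_swap {n m : ℕ} {h : Tensor n m} (hh : IsInvariant h) (x : Fin n → ℝ)
    {i j : Fin n} (hij : i ≠ j) :
    h (fun _ => diagEl n (x ∘ Equiv.swap i j)) = h (fun _ => diagEl n x) := by
  -- Split `x` into a part fixed by the transposition and the half difference `δ` along `e_i - e_j`;
  -- the transposition flips the sign of `δ`.
  set a := (x i + x j) / 2
  set δ := (x i - x j) / 2
  set x₀ := Function.update (Function.update x i a) j a with hx₀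
  have hx : x = x₀ + δ • (Pi.single i 1 - Pi.single j 1) := by
    ext l
    by_cases h1 : l = i
    · subst h1; simp [hx₀, hij, a, δ]; ring
    · by_cases h2 : l = j
      · subst h2; simp [hx₀, h1, a, δ]; ring
      · simp [hx₀, h1, h2]
  have hx' : x ∘ Equiv.swap i j = x₀ - δ • (Pi.single i 1 - Pi.single j 1) := by
    ext l
    by_cases h1 : l = i
    · subst h1; simp [hx₀, hij, a, δ]; ring
    · by_cases h2 : l = j
      · subst h2; simp [hx₀, h1, a, δ]; ring
      · simp [hx₀, h1, h2, Equiv.swap_apply_of_ne_of_ne]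
  -- A copy of `su(2)` in the coordinates `i, j`: `ad Y` rotates the diagonal direction into the
  -- off-diagonal matrix of `hV`, with the factor `1/2` giving unit angular speed.
  have hY : ((1 / 2 : ℂ) • (Matrix.single j i 1 - Matrix.single i j 1) :
      Matrix (Fin n) (Fin n) ℂ) ∈ su n := by
    refine ⟨?_, ?_⟩
    · simp [Matrix.conjTranspose_smul, ← smul_neg]
    · simp [hij, hij.symm]
  have hV : ((-Complex.I) • (Matrix.single j i 1 + Matrix.single i j 1) :
      Matrix (Fin n) (Fin n) ℂ) ∈ su n := by
    refine ⟨?_, ?_⟩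
    · rw [Matrix.conjTranspose_smul, Matrix.conjTranspose_add, Matrix.conjTranspose_single,
        Matrix.conjTranspose_single, star_one, star_neg, Complex.star_def, Complex.conj_I,
        neg_neg, neg_smul, neg_neg, add_comm]
    · simp [hij, hij.symm]
  have hcoe : (diagEl n (Pi.single i 1 - Pi.single j 1) : Matrix (Fin n) (Fin n) ℂ) =
      (-Complex.I) • (Matrix.single i i 1 - Matrix.single j j 1) := by
    rw [diagEl_coe]
    ext p q
    by_cases hpq : p = q
    · subst hpq
      simp only [Matrix.diagonal_apply_eq, Matrix.smul_apply, Matrix.sub_apply,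
        Matrix.single_apply, Pi.sub_apply, Pi.single_apply, Finset.sum_sub_distrib]
      by_cases h1 : p = i <;> by_cases h2 : p = j <;>
        simp [h1, h2, hij, Ne.symm hij, @eq_comm _ i p, @eq_comm _ j p]
    · simp only [Matrix.diagonal_apply_ne _ hpq, Matrix.smul_apply, Matrix.sub_apply,
        Matrix.single_apply]
      rw [if_neg (by grind), if_neg (by grind)]
      simp
  rw [hx']
  conv_rhs => rw [hx]
  rw [map_add, map_sub, map_smul]
  refine (hh.rotation (Y := ⟨_, hY⟩) (V₂ := δ • ⟨_, hV⟩) ?_ ?_ ?_).symm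
  · ext p q
    rw [lie_coe_diagonal _ _ _ (diagEl_coe n x₀)]
    simp only [Matrix.smul_apply, Matrix.sub_apply, Matrix.single_apply]
    have : x₀ i = x₀ j := by simp [hx₀, hij]
    by_cases h1 : j = p ∧ i = q
    · obtain ⟨rfl, rfl⟩ := h1
      simp [this]
    · by_cases h2 : i = p ∧ j = q
      · obtain ⟨rfl, rfl⟩ := h2
        simp [this]
      · simp [h1, h2]
  · rw [lie_smul]
    congr 1
    ext1
    rw [LieSubalgebra.coe_bracket, Ring.lie_def, hcoe]
    simp only [smul_mul_smul_comm, sub_mul, mul_sub, Matrix.single_mul_single_same, mul_one,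
      Matrix.single_mul_single_of_ne, ne_eq, hij, hij.symm, not_false_eq_true]
    module
  · rw [lie_smul, ← smul_neg]
    congr 1
    ext1
    rw [LieSubalgebra.coe_bracket, Ring.lie_def]
    change _ = -(diagEl n (Pi.single i 1 - Pi.single j 1) : Matrix (Fin n) (Fin n) ℂ)
    rw [hcoe]
    simp only [smul_mul_smul_comm, sub_mul, mul_add, add_mul, mul_sub, mul_one,
      Matrix.single_mul_single_same, Matrix.single_mul_single_of_ne, ne_eq, hij, hij.symm,
      not_false_eq_true]
    module

theorem IsInvariant.diagEl_perm {n m : ℕ} {h : Tensor n m} (hh : IsInvariant h)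
    (σ : Equiv.Perm (Fin n)) : ∀ x : Fin n → ℝ,
    h (fun _ => diagEl n (x ∘ σ)) = h (fun _ => diagEl n x) := by
  induction σ using Equiv.Perm.swap_induction_on with
  | one => intro x; rfl
  | swap_mul f i j hij ih =>
    intro x
    rw [Equiv.Perm.coe_mul, ← Function.comp_assoc, ih, hh.diagEl_swap x hij]

/-- The polynomial function given by a tensor on the Cartan subalgebra. -/
noncomputable def cartanPoly {n m : ℕ} (h : Tensor n m) : MvPolynomial (Fin n) ℝ :=
  ∑ r : Fin m → Fin n,
    MvPolynomial.C (h fun j => diagEl n (Pi.single (r j) 1)) * ∏ j, MvPolynomial.X (r j)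

theorem eval_cartanPoly {n m : ℕ} (h : Tensor n m) (x : Fin n → ℝ) :
    MvPolynomial.eval x (cartanPoly h) = h (fun _ => diagEl n x) := by
  have hx : x = ∑ i, x i • Pi.single i (1 : ℝ) := by
    ext l
    simp [Finset.sum_apply, Pi.single_apply]
  conv_rhs => rw [hx]
  simp_rw [map_sum, map_smul]
  rw [h.map_sum (fun _ i => x i • diagEl n (Pi.single i 1))]
  rw [cartanPoly, map_sum]
  refine Finset.sum_congr rfl fun r _ => ?_
  rw [h.map_smul_univ (fun j => x (r j)) (fun j => diagEl n (Pi.single (r j) 1))]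
  simp [mul_comm]

theorem cartanPoly_isHomogeneous {n m : ℕ} (h : Tensor n m) : (cartanPoly h).IsHomogeneous m := by
  refine MvPolynomial.IsHomogeneous.sum _ _ _ fun r _ => ?_
  have h1 := MvPolynomial.IsHomogeneous.prod Finset.univ (fun j => MvPolynomial.X (R := ℝ) (r j))
    (fun _ => 1) fun j _ => MvPolynomial.isHomogeneous_X ℝ (r j)
  simpa using (MvPolynomial.isHomogeneous_C _ _).mul h1

theorem IsInvariant.cartanPoly_isSymmetric {n m : ℕ} {h : Tensor n m} (hh : IsInvariant h) :
    (cartanPoly h).IsSymmetric := by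
  intro σ
  refine MvPolynomial.funext fun x => ?_
  rw [MvPolynomial.eval_rename, eval_cartanPoly, eval_cartanPoly, hh.diagEl_perm]

/-- An invariant symmetric tensor is determined by its restriction to the Cartan subalgebra. -/
theorem eq_of_diagEl {n m : ℕ} {f g : Tensor n m} (hf : f ∈ invSymm n m) (hg : g ∈ invSymm n m)
    (h : ∀ x, f (fun _ => diagEl n x) = g (fun _ => diagEl n x)) : f = g := by
  rw [← sub_eq_zero]
  refine eq_zero_of_cartan ((invSymm n m).sub_mem hf hg) fun D hD => ?_
  obtain ⟨x, rfl⟩ := exists_diagEl_eq hD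
  rw [sub_apply, h, sub_self]

/-! ### Centred power sums as generators of the symmetric polynomials -/

open MvPolynomial

/-- The mean of the variables. -/
noncomputable def meanPoly (n : ℕ) : MvPolynomial (Fin n) ℝ := C ((n : ℝ)⁻¹) * psum (Fin n) ℝ 1

/-- The power sums of the deviations of the variables from their mean. -/
noncomputable def centredPsum (n p : ℕ) : MvPolynomial (Fin n) ℝ :=
  ∑ i, (X i - meanPoly n) ^ p

/-- Generators of the symmetric polynomials: the sum of the variables and the centred
power sums. -/
noncomputable def symmGen (n : ℕ) (i : Fin n) : MvPolynomial (Fin n) ℝ :=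
  if (i : ℕ) = 0 then psum (Fin n) ℝ 1 else centredPsum n (i + 1)

theorem centredPsum_one {n : ℕ} (hn : 0 < n) : centredPsum n 1 = 0 := by
  simp only [centredPsum, pow_one, Finset.sum_sub_distrib, Finset.sum_const, Finset.card_univ,
    Fintype.card_fin, meanPoly, psum]
  rw [nsmul_eq_mul, ← mul_assoc, ← map_natCast C, ← C_mul,
    mul_inv_cancel₀ (by positivity), C_1, one_mul, sub_self]

theorem meanPoly_isSymmetric (n : ℕ) : (meanPoly n).IsSymmetric :=
  (IsSymmetric.C _).mul (psum_isSymmetric _ _ _)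

theorem centredPsum_isSymmetric (n p : ℕ) : (centredPsum n p).IsSymmetric := by
  intro σ
  rw [centredPsum, map_sum]
  refine Fintype.sum_equiv σ _ _ fun i => ?_
  rw [map_pow, map_sub, rename_X, meanPoly_isSymmetric n σ]

theorem symmGen_isSymmetric (n : ℕ) (i : Fin n) : (symmGen n i).IsSymmetric := by
  rw [symmGen]
  split_ifs
  · exact psum_isSymmetric _ _ _
  · exact centredPsum_isSymmetric _ _

theorem centredPsum_isHomogeneous (n p : ℕ) : (centredPsum n p).IsHomogeneous p := by
  refine IsHomogeneous.sum _ _ _ fun i _ => ?_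
  have h1 : (psum (Fin n) ℝ 1).IsHomogeneous 1 := by
    rw [psum_one]
    exact IsHomogeneous.sum _ _ _ fun i _ => isHomogeneous_X _ _
  have h2 : (meanPoly n).IsHomogeneous 1 := by
    rw [meanPoly]
    exact zero_add 1 ▸ (isHomogeneous_C (Fin n) ((n : ℝ)⁻¹)).mul h1
  simpa using ((isHomogeneous_X ℝ i).sub h2).pow p

theorem psum_one_mem (n : ℕ) (hn : 0 < n) :
    psum (Fin n) ℝ 1 ∈ Algebra.adjoin ℝ (Set.range (symmGen n)) :=
  Algebra.subset_adjoin ⟨⟨0, hn⟩, by simp [symmGen]⟩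

theorem centredPsum_mem {n : ℕ} (hn : 0 < n) {p : ℕ} (hp : p ≤ n) :
    centredPsum n p ∈ Algebra.adjoin ℝ (Set.range (symmGen n)) := by
  match p, hp with
  | 0, _ =>
    simp only [centredPsum, pow_zero, Finset.sum_const, nsmul_eq_mul, mul_one]
    exact natCast_mem _ _
  | 1, _ =>
    rw [centredPsum_one hn]
    exact zero_mem _
  | p + 2, hp =>
    exact Algebra.subset_adjoin ⟨⟨p + 1, hp⟩, by simp [symmGen]⟩

/-- Binomial expansion of each variable as deviation plus mean. -/
theorem psum_mem {n : ℕ} (hn : 0 < n) {p : ℕ} (hp : p ≤ n) :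
    psum (Fin n) ℝ p ∈ Algebra.adjoin ℝ (Set.range (symmGen n)) := by
  have h1 : psum (Fin n) ℝ p = ∑ k ∈ Finset.range (p + 1),
      centredPsum n k * meanPoly n ^ (p - k) * (p.choose k : MvPolynomial (Fin n) ℝ) := by
    simp_rw [centredPsum, Finset.sum_mul]
    rw [Finset.sum_comm, psum]
    refine Finset.sum_congr rfl fun i _ => ?_
    rw [← add_pow, sub_add_cancel]
  have h2 : meanPoly n ∈ Algebra.adjoin ℝ (Set.range (symmGen n)) :=
    mul_mem (Subalgebra.algebraMap_mem _ _) (psum_one_mem n hn)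
  rw [h1]
  refine sum_mem fun k hk => mul_mem (mul_mem (centredPsum_mem hn ?_) (pow_mem h2 _))
    (natCast_mem _ _)
  have := Finset.mem_range.mp hk
  omega

/-- Newton's identities express `k e_k` through lower `e_j` and power sums, and `k` is invertible in
`ℝ`. -/
theorem esymm_mem {n : ℕ} (hn : 0 < n) (k : ℕ) (hk : k ≤ n) :
    esymm (Fin n) ℝ k ∈ Algebra.adjoin ℝ (Set.range (symmGen n)) := by
  induction k using Nat.strong_induction_on with
  | _ k ih =>
    rcases Nat.eq_zero_or_pos k with rfl | hpos
    · rw [esymm_zero]; exact one_mem _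
    · have h1 := mul_esymm_eq_sum (Fin n) ℝ k
      have h2 : (k : MvPolynomial (Fin n) ℝ) * esymm (Fin n) ℝ k ∈
          Algebra.adjoin ℝ (Set.range (symmGen n)) := by
        rw [h1]
        refine mul_mem (pow_mem (neg_mem (one_mem _)) _) (sum_mem fun a ha => ?_)
        obtain ⟨ha1, ha2⟩ := Finset.mem_filter.mp ha
        have ha3 := Finset.HasAntidiagonal.mem_antidiagonal.mp ha1
        exact mul_mem (mul_mem (pow_mem (neg_mem (one_mem _)) _) (ih _ ha2 (by omega)))
          (psum_mem hn (by omega))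
      have h3 : esymm (Fin n) ℝ k = (k : ℝ)⁻¹ • ((k : MvPolynomial (Fin n) ℝ) *
          esymm (Fin n) ℝ k) := by
        rw [← nsmul_eq_mul, ← Nat.cast_smul_eq_nsmul ℝ, smul_smul,
          inv_mul_cancel₀ (by positivity), one_smul]
      rw [h3]
      exact Subalgebra.smul_mem _ h2 _

theorem mem_adjoin_of_isSymmetric {n : ℕ} (hn : 0 < n) {p : MvPolynomial (Fin n) ℝ}
    (hp : p.IsSymmetric) : p ∈ Algebra.adjoin ℝ (Set.range (symmGen n)) := by
  obtain ⟨q, hq⟩ := esymmAlgHom_surjective (σ := Fin n) (n := n) ℝ (by simp) ⟨p, hp⟩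
  have h1 := congrArg Subtype.val hq
  rw [esymmAlgHom_apply] at h1
  change _ = p at h1
  rw [← h1, aeval_def, eval₂_eq]
  refine sum_mem fun d _ => mul_mem (Subalgebra.algebraMap_mem _ _) (prod_mem fun i _ =>
    pow_mem (esymm_mem hn _ i.2) _)

/-- The algebra of symmetric polynomials has transcendence degree `n`, by the elementary symmetric
polynomials. A family of `n` elements that generates it must therefore be a transcendence basis. -/
theorem algebraicIndependent_symmGen {n : ℕ} (hn : 0 < n) :
    AlgebraicIndependent ℝ (symmGen n) := by
  let g : Fin n → symmetricSubalgebra (Fin n) ℝ := fun i => ⟨symmGen n i, symmGen_isSymmetric n i⟩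
  have hg : Algebra.adjoin ℝ (Set.range g) = ⊤ := by
    rw [eq_top_iff]
    rintro ⟨p, hp⟩ -
    have h1 := mem_adjoin_of_isSymmetric hn hp
    have h2 : Set.range (symmGen n) = (symmetricSubalgebra (Fin n) ℝ).val '' Set.range g := by
      rw [← Set.range_comp]; rfl
    rw [h2, ← AlgHom.map_adjoin] at h1
    obtain ⟨q, hq, hqp⟩ := h1
    have : q = ⟨p, hp⟩ := Subtype.ext hqp
    exact this ▸ hq
  have hsurj : Function.Surjective
      (algebraMap (Algebra.adjoin ℝ (Set.range g)) (symmetricSubalgebra (Fin n) ℝ)) :=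
    fun p => ⟨⟨p, hg ▸ Algebra.mem_top⟩, rfl⟩
  have halg : Algebra.IsAlgebraic (Algebra.adjoin ℝ (Set.range g))
      (symmetricSubalgebra (Fin n) ℝ) :=
    ⟨fun p => (hsurj p).choose_spec ▸ isAlgebraic_algebraMap _⟩
  have htr : Algebra.trdeg ℝ (symmetricSubalgebra (Fin n) ℝ) = Cardinal.mk (Fin n) := by
    rw [← (esymmAlgEquiv ℝ (σ := Fin n) (n := n) (by simp)).trdeg_eq]
    simp
  have hfaith : FaithfulSMul ℝ (symmetricSubalgebra (Fin n) ℝ) :=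
    (faithfulSMul_iff_algebraMap_injective _ _).mpr (algebraMap ℝ _).injective
  have h1 := (Algebra.IsAlgebraic.isTranscendenceBasis_of_le_trdeg_of_finite ℝ g htr.ge).1
  exact h1.map' (f := (symmetricSubalgebra (Fin n) ℝ).val) Subtype.val_injective

/-! ### Elementary symmetric functions in terms of power sums -/

/-- The number `∏ νⱼ! j^νⱼ` attached to a multiset with multiplicities `νⱼ`. -/
noncomputable def centraliserOrder (s : Multiset ℕ) : ℝ :=
  ∏ j ∈ s.toFinset, ((s.count j)! * j ^ s.count j : ℝ)

theorem centraliserOrder_cons (j : ℕ) (t : Multiset ℕ) :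
    centraliserOrder (j ::ₘ t) = ((j ::ₘ t).count j * j : ℝ) * centraliserOrder t := by
  have h1 : centraliserOrder t = ∏ i ∈ (j ::ₘ t).toFinset, ((t.count i)! * i ^ t.count i : ℝ) := by
    refine Finset.prod_subset ?_ fun i _ hi => ?_
    · intro i hi
      rw [Multiset.mem_toFinset] at hi ⊢
      exact Multiset.mem_cons_of_mem hi
    · rw [Multiset.count_eq_zero_of_notMem (by simpa using hi)]
      simp
  have hj : j ∈ (j ::ₘ t).toFinset := by simp
  rw [h1, centraliserOrder, ← Finset.mul_prod_erase _ _ hj, ← Finset.mul_prod_erase _ _ hj,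
    ← mul_assoc, Multiset.count_cons_self]
  congr 1
  · rw [Nat.factorial_succ, pow_succ]
    push_cast
    ring
  · refine Finset.prod_congr rfl fun i hi => ?_
    rw [Multiset.count_cons_of_ne (Finset.ne_of_mem_erase hi)]

theorem centraliserOrder_ne_zero {s : Multiset ℕ} (hs : ∀ i ∈ s, 0 < i) :
    centraliserOrder s ≠ 0 := by
  refine Finset.prod_ne_zero_iff.mpr fun j hj => ?_
  have := hs j (Multiset.mem_toFinset.mp hj)
  positivity

/-- The term of the power sum expansion of the elementary symmetric functions that belongs to the
multiset `s` of indices. -/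
noncomputable def newtonTerm (p : ℕ → ℝ) (s : Multiset ℕ) : ℝ :=
  (-1) ^ (s.filter Even).card / centraliserOrder s * (s.map p).prod

/-- Adding a part `j` multiplies the centraliser order by `j` times its new multiplicity, and the
sign by `(-1)^(j+1)`. -/
theorem newtonTerm_cons (p : ℕ → ℝ) {j : ℕ} {t : Multiset ℕ} (hj : 0 < j) (ht : ∀ i ∈ t, 0 < i) :
    ((j ::ₘ t).count j * j : ℝ) * newtonTerm p (j ::ₘ t) =
      (-1) ^ (j + 1) * p j * newtonTerm p t := by
  have h1 := centraliserOrder_ne_zero ht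
  have h2 : ((j ::ₘ t).count j * j : ℝ) ≠ 0 := by
    rw [Multiset.count_cons_self]
    positivity
  have h3 : (-1 : ℝ) ^ ((j ::ₘ t).filter Even).card =
      (-1) ^ (j + 1) * (-1) ^ (t.filter Even).card := by
    by_cases he : Even j
    · rw [Multiset.filter_cons_of_pos _ he, Multiset.card_cons, pow_succ, he.add_one.neg_one_pow]
      ring
    · rw [Multiset.filter_cons_of_neg _ he, (Nat.not_even_iff_odd.mp he).add_one.neg_one_pow,
        one_mul]
  rw [newtonTerm, newtonTerm, centraliserOrder_cons, h3, Multiset.map_cons, Multiset.prod_cons]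
  field_simp

/-- The recursion of Newton's identities. Write `m` as the sum of `ν_j j` over the distinct parts of
`μ`; deleting one part `j` matches the pairs `(μ, j)` with the partitions of `m - j`. -/
theorem mul_sum_newtonTerm (p : ℕ → ℝ) (m : ℕ) :
    (m : ℝ) * ∑ μ : m.Partition, newtonTerm p μ.parts =
      ∑ a ∈ Finset.HasAntidiagonal.antidiagonal m with a.1 < m,
        (-1) ^ (a.2 + 1) * p a.2 * ∑ ν : a.1.Partition, newtonTerm p ν.parts := by
  have h1 : (m : ℝ) * ∑ μ : m.Partition, newtonTerm p μ.parts =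
      ∑ μ : m.Partition, ∑ j ∈ μ.parts.toFinset,
        (μ.parts.count j * j : ℝ) * newtonTerm p μ.parts := by
    rw [Finset.mul_sum]
    refine Finset.sum_congr rfl fun μ _ => ?_
    rw [← Finset.sum_mul]
    congr 1
    have h2 := Finset.sum_multiset_count μ.parts
    rw [μ.parts_sum] at h2
    conv_lhs => rw [h2]
    push_cast
    simp
  rw [h1]
  simp_rw [Finset.mul_sum]
  rw [Finset.sum_sigma', Finset.sum_sigma']
  symm
  have hmem : ∀ x : (Σ a : ℕ × ℕ, a.1.Partition),
      x ∈ ((Finset.HasAntidiagonal.antidiagonal m).filter fun a => a.1 < m).sigma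
        (fun a => (Finset.univ : Finset a.1.Partition)) → x.1.1 + x.1.2 = m ∧ 0 < x.1.2 := by
    intro x hx
    obtain ⟨h2, h3⟩ := Finset.mem_filter.mp (Finset.mem_sigma.mp hx).1
    have h4 := Finset.HasAntidiagonal.mem_antidiagonal.mp h2
    omega
  refine Finset.sum_bij (fun x hx => ⟨⟨x.1.2 ::ₘ x.2.parts, ?_, ?_⟩, x.1.2⟩) ?_ ?_ ?_ ?_
  · intro i hi
    rcases Multiset.mem_cons.mp hi with rfl | hi
    · exact (hmem x hx).2
    · exact x.2.parts_pos hi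
  · rw [Multiset.sum_cons, x.2.parts_sum, add_comm]
    exact (hmem x hx).1
  · intro x hx
    simp
  · rintro ⟨⟨a, b⟩, ν⟩ hx ⟨⟨a', b'⟩, ν'⟩ hx' h
    have e1 := (hmem _ hx).1
    have e2 := (hmem _ hx').1
    simp only [Sigma.mk.injEq, Nat.Partition.mk.injEq, heq_eq_eq] at h e1 e2
    obtain ⟨h3, rfl⟩ := h
    obtain rfl : a = a' := by omega
    obtain rfl : ν = ν' := Nat.Partition.ext ((Multiset.cons_inj_right b).mp h3)
    rfl
  · rintro ⟨μ, j⟩ hx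
    have hj : j ∈ μ.parts := by simpa using hx
    have hpos := μ.parts_pos hj
    have hsum : j + (μ.parts.erase j).sum = m := by
      rw [← Multiset.sum_cons, Multiset.cons_erase hj, μ.parts_sum]
    refine ⟨⟨⟨m - j, j⟩, ⟨μ.parts.erase j, fun hi => μ.parts_pos (Multiset.mem_of_mem_erase hi), ?_⟩⟩,
      ?_, ?_⟩
    · change (μ.parts.erase j).sum = m - j
      omega
    · simp
      omega
    · simp only [Sigma.mk.injEq, heq_eq_eq, and_true]
      exact Nat.Partition.ext (Multiset.cons_erase hj)
  · rintro ⟨⟨a, b⟩, ν⟩ hx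
    exact (newtonTerm_cons p (hmem _ hx).2 fun i hi => ν.parts_pos hi).symm

/-- The expansion of the elementary symmetric functions in power sums. -/
theorem eval_esymm_eq_sum {n : ℕ} (x : Fin n → ℝ) (m : ℕ) :
    MvPolynomial.eval x (MvPolynomial.esymm (Fin n) ℝ m) =
      ∑ μ : m.Partition, newtonTerm (fun p => ∑ i, x i ^ p) μ.parts := by
  induction m using Nat.strong_induction_on with
  | _ m ih =>
    rcases Nat.eq_zero_or_pos m with rfl | hm
    · simp [newtonTerm, centraliserOrder]
    · have h1 := congrArg (MvPolynomial.eval x) (MvPolynomial.mul_esymm_eq_sum (Fin n) ℝ m)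
      have hm' : (m : ℝ) ≠ 0 := by positivity
      refine mul_left_cancel₀ hm' ?_
      rw [mul_sum_newtonTerm]
      rw [map_mul, map_natCast] at h1
      rw [h1, map_mul, map_sum, Finset.mul_sum]
      refine Finset.sum_congr rfl fun a ha => ?_
      obtain ⟨h2, h3⟩ := Finset.mem_filter.mp ha
      have h4 := Finset.HasAntidiagonal.mem_antidiagonal.mp h2
      rw [← ih a.1 h3, ← h4]
      simp only [map_mul, map_pow, map_neg, map_one, MvPolynomial.psum, map_sum,
        MvPolynomial.eval_X]
      rw [show (-1 : ℝ) ^ (a.2 + 1) = (-1) ^ (a.1 + a.2 + 1) * (-1) ^ a.1 by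
        rw [← pow_add, show a.1 + a.2 + 1 + a.1 = 2 * a.1 + (a.2 + 1) by ring, pow_add _ (2 * a.1),
          pow_mul]
        simp]
      ring

/-! ### Diagonalisation and the expansion of the contraction -/

theorem exists_eigenvalues {n : ℕ} (X : su n) : ∃ x : Fin n → ℝ,
    (∀ p, k n p (fun _ => X) = ∑ i, x i ^ p) ∧
    ∀ m, antisymTrace (fun _ : Fin m => herm n X) =
      antisymTrace (fun _ : Fin m => Matrix.diagonal fun i => (x i : ℂ)) := by
  have hX : (herm n X).IsHermitian := herm_conjTranspose X
  let U : Matrix (Fin n) (Fin n) ℂ := (hX.eigenvectorUnitary).1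
  have hU : star U * U = 1 := Unitary.coe_star_mul_self hX.eigenvectorUnitary
  set D : Matrix (Fin n) (Fin n) ℂ := Matrix.diagonal fun i => (hX.eigenvalues i : ℂ) with hD
  have h1 : herm n X = U * D * star U := by
    conv_lhs => rw [hX.spectral_theorem, Unitary.conjStarAlgAut_apply]
    rfl
  refine ⟨hX.eigenvalues, fun p => ?_, fun m => ?_⟩
  · have h2 : (herm n X) ^ p = U * D ^ p * star U := by
      rw [h1]
      induction p with
      | zero =>
        have : U * star U = 1 := mul_eq_one_comm.mp hU
        simp [this]
      | succ p ih =>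
        rw [pow_succ, ih, pow_succ]
        calc U * D ^ p * star U * (U * D * star U) = U * D ^ p * (star U * U) * D * star U := by
              noncomm_ring
          _ = _ := by rw [hU]; noncomm_ring
    rw [k_diag, h2, Matrix.trace_mul_comm, ← mul_assoc, hU, one_mul, hD, Matrix.diagonal_pow,
      Matrix.trace_diagonal, Complex.re_sum]
    refine Finset.sum_congr rfl fun i _ => ?_
    rw [Pi.pow_apply, ← Complex.ofReal_pow, Complex.ofReal_re]
  · rw [← hD, h1, antisymTrace_mul_comm, ← mul_assoc, hU, one_mul]

/-- The antisymmetrised contraction as a multilinear map. -/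
noncomputable def antisymTensor (n m : ℕ) : MultilinearMap ℝ (fun _ : Fin m => su n) ℂ :=
  ∑ α : Fin m → Fin n, ∑ β : Fin m → Fin n, (eps α β : ℝ) •
    (MultilinearMap.mkPiAlgebra ℝ (Fin m) ℂ).compLinearMap fun j =>
      (Matrix.entryLinearMap ℝ ℂ (α j) (β j)) ∘ₗ herm n

theorem antisymTensor_apply {n m : ℕ} (X : Fin m → su n) :
    antisymTensor n m X = antisymTrace fun j => herm n (X j) := by
  simp [antisymTensor, antisymTrace]

/-- Renaming the slots conjugates the summation permutation by `σ`, which preserves its sign. -/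
theorem eps_comp_perm {n m : ℕ} (α β : Fin m → Fin n) (σ : Equiv.Perm (Fin m)) :
    eps (α ∘ σ) (β ∘ σ) = eps α β := by
  refine Fintype.sum_equiv (MulAut.conj σ).toEquiv _ _ fun τ => ?_
  congr 1
  · have : Equiv.Perm.sign (σ * τ * σ⁻¹) = Equiv.Perm.sign τ := by
      rw [Equiv.Perm.sign_mul, Equiv.Perm.sign_mul, Equiv.Perm.sign_inv, mul_right_comm,
        Int.units_mul_self, one_mul]
    exact congrArg Units.val this.symm
  · rw [← Equiv.prod_comp σ fun j => if α j = β ((MulAut.conj σ).toEquiv τ j) then (1 : ℤ) else 0]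
    simp

theorem antisymTrace_comp_perm {n m : ℕ} (A : Fin m → Matrix (Fin n) (Fin n) ℂ)
    (σ : Equiv.Perm (Fin m)) : antisymTrace (fun j => A (σ j)) = antisymTrace A := by
  refine Fintype.sum_equiv (Equiv.arrowCongr σ (Equiv.refl _)) _ _ fun α =>
    Fintype.sum_equiv (Equiv.arrowCongr σ (Equiv.refl _)) _ _ fun β => ?_
  change _ = (eps (α ∘ σ.symm) (β ∘ σ.symm) : ℂ) * ∏ j, A j (α (σ.symm j)) (β (σ.symm j))
  rw [← Equiv.prod_comp σ fun j => A j (α (σ.symm j)) (β (σ.symm j)),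
    ← eps_comp_perm (α ∘ σ.symm) (β ∘ σ.symm) σ]
  simp [Function.comp_def]

theorem cauchyNumber_mul_eq {m : ℕ} (μ : m.Partition) (p : ℕ → ℝ) :
    cycleSign μ * cauchyNumber μ * (μ.parts.map p).prod =
      (m ! : ℝ) * newtonTerm p μ.parts := by
  rw [cycleSign, cauchyNumber, newtonTerm, centraliserOrder]
  ring

/-- Both sides are symmetric and multilinear, so it suffices to take all `X j` equal; in terms of
eigenvalues both are then `m! e_m`. -/
theorem antisymTrace_expansion {n m : ℕ} (X : Fin m → su n) :
    antisymTrace (fun j => Complex.I • (X j : Matrix (Fin n) (Fin n) ℂ)) =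
      ((∑ μ : m.Partition, cycleSign μ * cauchyNumber μ * kPart n μ X : ℝ) : ℂ) := by
  let F : MultilinearMap ℝ (fun _ : Fin m => su n) ℂ := antisymTensor n m -
    (Algebra.linearMap ℝ ℂ).compMultilinearMap
      (∑ μ : m.Partition, (cycleSign μ * cauchyNumber μ) • kPart n μ)
  have hF : ∀ X, F X = antisymTrace (fun j => herm n (X j)) -
      ((∑ μ : m.Partition, cycleSign μ * cauchyNumber μ * kPart n μ X : ℝ) : ℂ) := by
    intro X
    simp [F, antisymTensor_apply]
  have h0 : F = 0 := by
    refine multilinear_eq_zero_of_diag F (fun σ v => ?_) fun Y => ?_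
    · rw [hF, hF, antisymTrace_comp_perm (fun j => herm n (v j)) σ]
      congr 3
      ext1 μ
      rw [(kPart_mem n μ).2 σ v]
    · obtain ⟨x, hx1, hx2⟩ := exists_eigenvalues Y
      rw [hF, hx2, antisymTrace_diagonal, sub_eq_zero]
      simp_rw [kPart_diag, hx1, cauchyNumber_mul_eq]
      rw [← Finset.mul_sum, ← eval_esymm_eq_sum, MvPolynomial.esymm, MvPolynomial.esymm]
      simp
  have h1 := hF X
  rw [h0, zero_apply] at h1
  exact (sub_eq_zero.mp h1.symm)

/-! ### The monomial basis -/

/-- Restriction to the Cartan subalgebra as a linear map into polynomials. -/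
noncomputable def cartanPolyₗ (n m : ℕ) : Tensor n m →ₗ[ℝ] MvPolynomial (Fin n) ℝ where
  toFun := cartanPoly
  map_add' f g := MvPolynomial.funext fun x => by
    rw [map_add, eval_cartanPoly, eval_cartanPoly, eval_cartanPoly, add_apply]
  map_smul' c f := MvPolynomial.funext fun x => by
    rw [RingHom.id_apply, MvPolynomial.smul_eval, eval_cartanPoly, eval_cartanPoly, smul_apply,
      smul_eq_mul]

theorem eval_centredPsum {n : ℕ} (p : ℕ) (x : Fin n → ℝ) :
    MvPolynomial.eval x (centredPsum n p) = k n p (fun _ => diagEl n x) := by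
  rw [k_diagEl, centredPsum, map_sum]
  refine Finset.sum_congr rfl fun i _ => ?_
  simp [meanPoly, MvPolynomial.psum, div_eq_inv_mul]

theorem cartanPoly_kPart (n : ℕ) {m : ℕ} (μ : m.Partition) :
    cartanPoly (kPart n μ) = (μ.parts.map (centredPsum n)).prod := by
  refine MvPolynomial.funext fun x => ?_
  rw [eval_cartanPoly, kPart_diag, map_multiset_prod, Multiset.map_map]
  congr 2
  ext1 p
  exact (eval_centredPsum p x).symm

/-- The exponents of a multiset of indices in terms of the generators `symmGen`. -/
noncomputable def exponents (n : ℕ) (s : Multiset ℕ) : Fin n →₀ ℕ :=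
  Finsupp.equivFunOnFinite.symm fun i => s.count ((i : ℕ) + 1)

theorem exponents_injective {n : ℕ} {s t : Multiset ℕ} (hs : ∀ p ∈ s, 2 ≤ p ∧ p ≤ n)
    (ht : ∀ p ∈ t, 2 ≤ p ∧ p ≤ n) (h : exponents n s = exponents n t) : s = t := by
  ext p
  by_cases hp : 1 ≤ p ∧ p ≤ n
  · have := DFunLike.congr_fun h (⟨p - 1, by omega⟩ : Fin n)
    simpa [exponents, Nat.sub_add_cancel hp.1] using this
  · rw [Multiset.count_eq_zero_of_notMem fun h1 => hp (by have := hs p h1; omega),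
      Multiset.count_eq_zero_of_notMem fun h1 => hp (by have := ht p h1; omega)]

theorem aeval_symmGen_monomial {n : ℕ} {s : Multiset ℕ} (hs : ∀ p ∈ s, 2 ≤ p ∧ p ≤ n) :
    MvPolynomial.aeval (symmGen n) (MvPolynomial.monomial (exponents n s) (1 : ℝ)) =
      (s.map (centredPsum n)).prod := by
  rw [MvPolynomial.aeval_monomial, map_one, one_mul, Finsupp.prod_fintype _ _ (by simp)]
  induction s using Multiset.induction_on with
  | empty => simp [exponents]
  | cons p s ih =>
    have hp := hs p (Multiset.mem_cons_self p s)
    rw [Multiset.map_cons, Multiset.prod_cons,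
      ← ih fun q hq => hs q (Multiset.mem_cons_of_mem hq)]
    let i : Fin n := ⟨p - 1, by omega⟩
    have hi : centredPsum n p = symmGen n i := by
      rw [symmGen, if_neg (by simp [i]; omega)]
      congr 1
      simp [i]
      omega
    rw [← Finset.mul_prod_erase _ _ (Finset.mem_univ i), ← Finset.mul_prod_erase _
      (fun j => symmGen n j ^ exponents n s j) (Finset.mem_univ i), ← mul_assoc, hi,
      ← pow_succ']
    congr 1
    · congr 1
      simp [exponents, i, Nat.sub_add_cancel (show 1 ≤ p by omega)]
    · refine Finset.prod_congr rfl fun j hj => ?_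
      congr 1
      have : (j : ℕ) + 1 ≠ p := fun h => Finset.ne_of_mem_erase hj (Fin.ext (by simp [i]; omega))
      simp [exponents, Multiset.count_cons_of_ne this]

/-- On the Cartan subalgebra the `k_μ` become distinct monomials in the algebraically independent
generators. -/
theorem linearIndependent_kPart {n : ℕ} (hn : 0 < n) (m : ℕ) :
    LinearIndependent ℝ (fun μ : Monomials n m => kPart n μ.1) := by
  refine LinearIndependent.of_comp (cartanPolyₗ n m) ?_
  have h1 : (cartanPolyₗ n m ∘ fun μ : Monomials n m => kPart n μ.1) =
      (MvPolynomial.aeval (symmGen n)).toLinearMap ∘ (MvPolynomial.basisMonomials (Fin n) ℝ) ∘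
        fun μ : Monomials n m => exponents n μ.1.parts := by
    ext1 μ
    simp only [Function.comp_apply, AlgHom.toLinearMap_apply, MvPolynomial.coe_basisMonomials]
    rw [aeval_symmGen_monomial μ.2]
    exact cartanPoly_kPart n μ.1
  rw [h1]
  refine LinearIndependent.map' ?_ _ (LinearMap.ker_eq_bot.mpr (algebraicIndependent_symmGen hn))
  refine (MvPolynomial.basisMonomials (Fin n) ℝ).linearIndependent.comp _ fun μ ν h => ?_
  exact Subtype.ext (Nat.Partition.ext (exponents_injective μ.2 ν.2 h))

/-- The multiset of indices with given exponents. -/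
def indices {n : ℕ} (d : Fin n →₀ ℕ) : Multiset ℕ := ∑ i, Multiset.replicate (d i) ((i : ℕ) + 1)

theorem prod_indices {n : ℕ} (d : Fin n →₀ ℕ) :
    ((indices d).map (centredPsum n)).prod = ∏ i : Fin n, centredPsum n (i + 1) ^ d i := by
  rw [indices, ← Multiset.coe_mapAddMonoidHom, map_sum, Multiset.prod_sum]
  simp

theorem mem_indices {n : ℕ} {d : Fin n →₀ ℕ} {p : ℕ} (hp : p ∈ indices d) :
    ∃ i : Fin n, (i : ℕ) + 1 = p ∧ d i ≠ 0 := by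
  obtain ⟨i, -, hi⟩ := Multiset.mem_sum.mp hp
  obtain ⟨h1, h2⟩ := Multiset.mem_replicate.mp hi
  exact ⟨i, h2.symm, h1⟩

theorem prod_centredPsum_isHomogeneous (n : ℕ) (s : Multiset ℕ) :
    ((s.map (centredPsum n)).prod).IsHomogeneous s.sum := by
  induction s using Multiset.induction_on with
  | empty => simpa using MvPolynomial.isHomogeneous_one (Fin n) ℝ
  | cons p s ih =>
    rw [Multiset.map_cons, Multiset.prod_cons, Multiset.sum_cons]
    exact (centredPsum_isHomogeneous n p).mul ih

theorem cartanPoly_mem_span {n m : ℕ} (hn : 0 < n) {h : Tensor n m} (hh : h ∈ invSymm n m) :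
    cartanPoly h ∈ Submodule.span ℝ
      (Set.range fun μ : Monomials n m => cartanPoly (kPart n μ.1)) := by
  have h1 := mem_adjoin_of_isSymmetric hn hh.1.cartanPoly_isSymmetric
  rw [Algebra.adjoin_range_eq_range_aeval] at h1
  obtain ⟨Q, hQ⟩ := h1
  change MvPolynomial.aeval (symmGen n) Q = cartanPoly h at hQ
  have hn' : (n : ℝ) ≠ 0 := by positivity
  have h2 : cartanPoly h = MvPolynomial.aeval (fun i : Fin n => centredPsum n (i + 1)) Q := by
    refine MvPolynomial.funext fun x => ?_
    -- Centring does not change the Cartan element but makes the first generator vanish, so that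
    -- generator may be replaced by the centred power sum of degree one, which is zero.
    let y : Fin n → ℝ := fun i => x i - (∑ j, x j) / n
    have hy : ∑ i, y i = 0 := by
      simp only [y]
      rw [Finset.sum_sub_distrib, Finset.sum_const, Finset.card_univ, Fintype.card_fin,
        nsmul_eq_mul, mul_div_cancel₀ _ hn', sub_self]
    have hxy : diagEl n y = diagEl n x := by
      ext1
      rw [diagEl_coe, diagEl_coe, hy]
      simp [y]
    have hgen : ∀ i : Fin n, MvPolynomial.eval y (symmGen n i) =
        MvPolynomial.eval x (centredPsum n (i + 1)) := by
      intro i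
      rw [symmGen]
      split_ifs with hi
      · rw [hi, zero_add, centredPsum_one hn, map_zero]
        simpa [MvPolynomial.psum] using hy
      · rw [eval_centredPsum, eval_centredPsum, hxy]
    rw [eval_cartanPoly, ← hxy, ← eval_cartanPoly, ← hQ]
    simp only [MvPolynomial.aeval_def, MvPolynomial.eval₂_eq, map_sum, map_mul, map_prod, map_pow,
      hgen, MvPolynomial.algebraMap_eq, MvPolynomial.eval_C]
  -- `Q` may contain monomials of any weight; homogeneity of `cartanPoly h` keeps only those of
  -- weight `m`.
  have h3 : cartanPoly h = ∑ d ∈ Q.support, Q.coeff d •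
      MvPolynomial.homogeneousComponent m ((indices d).map (centredPsum n)).prod := by
    rw [← MvPolynomial.homogeneousComponent_eq_self (cartanPoly_isHomogeneous h), h2,
      MvPolynomial.aeval_def, MvPolynomial.eval₂_eq', map_sum]
    refine Finset.sum_congr rfl fun d _ => ?_
    rw [prod_indices, MvPolynomial.algebraMap_eq, MvPolynomial.homogeneousComponent_C_mul,
      MvPolynomial.smul_eq_C_mul]
  rw [h3]
  refine Submodule.sum_mem _ fun d _ => Submodule.smul_mem _ _ ?_
  rw [MvPolynomial.homogeneousComponent_of_mem (prod_centredPsum_isHomogeneous n _)]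
  split_ifs with hd
  -- A monomial that involves the generator of degree one contributes zero; any other gives a
  -- partition without parts equal to `1`.
  · by_cases h0 : d ⟨0, hn⟩ = 0
    · refine Submodule.subset_span ⟨⟨⟨indices d, fun hp => ?_, hd.symm⟩, fun p hp => ?_⟩, ?_⟩
      · obtain ⟨i, rfl, -⟩ := mem_indices hp
        omega
      · obtain ⟨i, rfl, hi⟩ := mem_indices hp
        refine ⟨?_, i.2⟩
        have : (i : ℕ) ≠ 0 := fun h4 => hi (by rw [← h0]; congr 1; exact Fin.ext h4)
        omega
      · exact cartanPoly_kPart n _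
    · rw [prod_indices, Finset.prod_eq_zero (Finset.mem_univ (⟨0, hn⟩ : Fin n))]
      · exact Submodule.zero_mem _
      · rw [zero_add, centredPsum_one hn, zero_pow h0]
  · exact Submodule.zero_mem _

theorem span_kPart {n : ℕ} (hn : 0 < n) (m : ℕ) :
    Submodule.span ℝ (Set.range fun μ : Monomials n m => kPart n μ.1) = invSymm n m := by
  refine le_antisymm (Submodule.span_le.mpr ?_) fun h hh => ?_
  · rintro _ ⟨μ, rfl⟩
    exact kPart_mem n μ.1
  · have h1 := cartanPoly_mem_span hn hh
    have h2 : (Set.range fun μ : Monomials n m => cartanPoly (kPart n μ.1)) =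
        cartanPolyₗ n m '' Set.range fun μ : Monomials n m => kPart n μ.1 := by
      rw [← Set.range_comp]; rfl
    rw [h2, ← Submodule.map_span] at h1
    obtain ⟨g, hg, hgh⟩ := h1
    have hg' : g ∈ invSymm n m := by
      refine Submodule.span_le.mpr ?_ hg
      rintro _ ⟨μ, rfl⟩
      exact kPart_mem n μ.1
    rw [← eq_of_diagEl hg' hh fun x => ?_]
    · exact hg
    · rw [← eval_cartanPoly, ← eval_cartanPoly]
      exact congrArg _ hgh

/-! ### Decomposable and primitive tensors -/

/-- Partitions with several parts give decomposable tensors. -/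
theorem kPart_mem_decomposable {n m : ℕ} (hm : 0 < m) (μ : m.Partition) (hμ : μ.parts ≠ {m}) :
    kPart n μ ∈ decomposable n m := by
  obtain ⟨p, hp⟩ : ∃ p, p ∈ μ.parts := by
    refine Multiset.exists_mem_of_ne_zero fun h => ?_
    have := μ.parts_sum
    rw [h, Multiset.sum_zero] at this
    omega
  obtain ⟨t, ht⟩ := Multiset.exists_cons_of_mem hp
  have hsum : p + t.sum = m := by rw [← Multiset.sum_cons, ← ht, μ.parts_sum]
  have htpos : ∀ {i}, i ∈ t → 0 < i := fun hi => μ.parts_pos (ht ▸ Multiset.mem_cons_of_mem hi)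
  obtain ⟨q, hq⟩ : ∃ q, q ∈ t := by
    refine Multiset.exists_mem_of_ne_zero fun h => hμ ?_
    subst h
    rw [Multiset.sum_zero, add_zero] at hsum
    rw [ht, hsum]
    rfl
  let ν : t.sum.Partition := ⟨t, htpos, rfl⟩
  have hmul := castOrder_mem hsum (symMul_mem (k_mem n p) (kPart_mem n ν))
  refine Submodule.subset_span ⟨p, t.sum, hsum, μ.parts_pos hp,
    (htpos hq).trans_le (Multiset.le_sum_of_mem hq), k n p, k_mem n p, kPart n ν, kPart_mem n ν,
    eq_of_diag (kPart_mem n μ).2 hmul.2 fun X => ?_⟩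
  rw [castOrder_diag, symMul_diag, kPart_diag, kPart_diag, ht, Multiset.map_cons,
    Multiset.prod_cons]

/-- Multiplying two basis monomials joins their partitions. Both orders are positive, so the result
has at least two parts. -/
theorem decomposable_le {n m : ℕ} (hn : 0 < n) : decomposable n m ≤ Submodule.span ℝ
    ((fun μ : Monomials n m => kPart n μ.1) '' {μ | μ.1.parts ≠ {m}}) := by
  refine Submodule.span_le.mpr ?_
  rintro _ ⟨p, q, rfl, hp, hq, f, hf, g, hg, rfl⟩
  have : Fintype (Monomials n p) := Fintype.ofFinite _
  have : Fintype (Monomials n q) := Fintype.ofFinite _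
  rw [← span_kPart hn] at hf hg
  obtain ⟨c, rfl⟩ := (Submodule.mem_span_range_iff_exists_fun ℝ).mp hf
  obtain ⟨d, rfl⟩ := (Submodule.mem_span_range_iff_exists_fun ℝ).mp hg
  let u : Monomials n p → Monomials n q → Monomials n (p + q) := fun μ ν =>
    ⟨⟨μ.1.parts + ν.1.parts, fun hi => (Multiset.mem_add.mp hi).elim μ.1.parts_pos ν.1.parts_pos,
      by rw [Multiset.sum_add, μ.1.parts_sum, ν.1.parts_sum]⟩,
      fun i hi => (Multiset.mem_add.mp hi).elim (μ.2 i) (ν.2 i)⟩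
  have hne : ∀ {r : ℕ} (μ : r.Partition), 0 < r → 0 < μ.parts.card := by
    intro r μ hr
    rw [Multiset.card_pos]
    intro h
    have := μ.parts_sum
    rw [h, Multiset.sum_zero] at this
    omega
  have h1 : ∀ μ ν, kPart n (u μ ν).1 ∈ Submodule.span ℝ
      ((fun μ : Monomials n (p + q) => kPart n μ.1) '' {μ | μ.1.parts ≠ {p + q}}) := by
    intro μ ν
    refine Submodule.subset_span ⟨u μ ν, fun h => ?_, rfl⟩
    have h2 := congrArg Multiset.card h
    simp only [u, Multiset.card_add, Multiset.card_singleton] at h2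
    have h3 := hne μ.1 hp
    have h4 := hne ν.1 hq
    omega
  have h2 : castOrder rfl (symMul (∑ μ, c μ • kPart n μ.1) (∑ ν, d ν • kPart n ν.1)) =
      ∑ μ, ∑ ν, (c μ * d ν) • kPart n (u μ ν).1 := by
    refine eq_of_diag (castOrder_mem rfl (symMul_mem ?_ ?_)).2 (Submodule.sum_mem _ fun μ _ =>
      Submodule.sum_mem _ fun ν _ => Submodule.smul_mem _ _ (kPart_mem n (u μ ν).1)).2 fun X => ?_
    · rwa [← span_kPart hn]
    · rwa [← span_kPart hn]
    · rw [castOrder_diag, symMul_diag]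
      simp only [sum_apply, smul_apply, smul_eq_mul, kPart_diag, Finset.sum_mul_sum, u,
        Multiset.map_add, Multiset.prod_add]
      refine Finset.sum_congr rfl fun μ _ => Finset.sum_congr rfl fun ν _ => ?_
      ring
  rw [SetLike.mem_coe, h2]
  exact Submodule.sum_mem _ fun μ _ => Submodule.sum_mem _ fun ν _ =>
    Submodule.smul_mem _ _ (h1 μ ν)

theorem kPart_of_parts_eq {n m : ℕ} (μ : m.Partition) (hμ : μ.parts = {m}) :
    kPart n μ = k n m := by
  refine eq_of_diag (kPart_mem n μ).2 (k_mem n m).2 fun X => ?_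
  rw [kPart_diag, hμ, Multiset.map_singleton, Multiset.prod_singleton]

/-- `k⁽ᵐ⁾` is itself the basis element of the one-part partition, so it is independent of those that
span the decomposables. -/
theorem k_notMem_decomposable {n m : ℕ} (h2 : 2 ≤ m) (hmn : m ≤ n) :
    k n m ∉ decomposable n m := by
  intro h
  let μ : Monomials n m := ⟨Nat.Partition.indiscrete m, fun p hp => by
    rw [Nat.Partition.indiscrete_parts (by omega), Multiset.mem_singleton] at hp
    omega⟩
  have hμ : μ.1.parts = {m} := Nat.Partition.indiscrete_parts (by omega)
  have h1 := (linearIndependent_kPart (n := n) (by omega) m).notMem_span_image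
    (s := {μ | μ.1.parts ≠ {m}}) (x := μ) (fun h3 => h3 hμ)
  rw [kPart_of_parts_eq μ.1 hμ] at h1
  exact h1 (decomposable_le (by omega) h)

theorem exists_sub_smul_k_mem {n m : ℕ} (hn : 0 < n) (hm : 0 < m) {h : Tensor n m}
    (hh : h ∈ invSymm n m) : ∃ c : ℝ, h - c • k n m ∈ decomposable n m := by
  have h1 : invSymm n m ≤ decomposable n m ⊔ Submodule.span ℝ {k n m} := by
    rw [← span_kPart hn, Submodule.span_le]
    rintro _ ⟨μ, rfl⟩
    by_cases hμ : μ.1.parts = {m}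
    · refine Submodule.mem_sup_right (Submodule.subset_span ?_)
      exact kPart_of_parts_eq μ.1 hμ
    · exact Submodule.mem_sup_left (kPart_mem_decomposable hm μ.1 hμ)
  obtain ⟨f, hf, g, hg, rfl⟩ := Submodule.mem_sup.mp (h1 hh)
  obtain ⟨c, rfl⟩ := Submodule.mem_span_singleton.mp hg
  exact ⟨c, by rwa [add_sub_cancel_right]⟩

theorem invSymm_le_decomposable {n m : ℕ} (hn : 0 < n) (hm : 0 < m) (h : ¬ (2 ≤ m ∧ m ≤ n)) :
    invSymm n m ≤ decomposable n m := by
  rw [← span_kPart hn, Submodule.span_le]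
  rintro _ ⟨μ, rfl⟩
  exact kPart_mem_decomposable hm μ.1 fun hμ => h (μ.2 m (by rw [hμ]; simp))

/-- There are `m!/m` cycles of length `m`, each of sign `(-1)^(m+1)`. -/
theorem cycleSign_mul_cauchyNumber_indiscrete {m : ℕ} (hm : 0 < m) :
    cycleSign (Nat.Partition.indiscrete m) * cauchyNumber (Nat.Partition.indiscrete m) =
      -((-1 : ℝ) ^ m * ((m - 1)! : ℝ)) := by
  have hm' : (m : ℝ) ≠ 0 := by positivity
  rw [cycleSign, cauchyNumber, Nat.Partition.indiscrete_parts hm.ne']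
  have h1 : (m ! : ℝ) = m * (m - 1)! := by
    rw [← Nat.mul_factorial_pred hm.ne']
    push_cast
    rfl
  have h2 : (-1 : ℝ) ^ (Multiset.filter Even {m}).card = -(-1) ^ m := by
    by_cases he : Even m
    · simp [Multiset.filter_singleton, he]
    · simp [Multiset.filter_singleton, he, Nat.not_even_iff_odd.mp he]
  rw [h2, h1]
  simp
  field_simp

theorem smul_k_eq_sum {n m : ℕ} (h : n < m) :
    ((-1 : ℝ) ^ m * ((m - 1)! : ℝ)) • k n m =
      ∑ μ ∈ (Finset.univ : Finset m.Partition).erase (Nat.Partition.indiscrete m),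
        (cycleSign μ * cauchyNumber μ) • kPart n μ := by
  have hm : 0 < m := by omega
  ext X
  have h1 := antisymTrace_expansion X
  rw [antisymTrace_eq_zero h] at h1
  have h2 : (∑ μ : m.Partition, cycleSign μ * cauchyNumber μ * kPart n μ X) = 0 := by
    exact_mod_cast h1.symm
  rw [← Finset.add_sum_erase _ _ (Finset.mem_univ (Nat.Partition.indiscrete m)),
    cycleSign_mul_cauchyNumber_indiscrete hm,
    kPart_of_parts_eq _ (Nat.Partition.indiscrete_parts hm.ne')] at h2
  simp only [sum_apply, smul_apply, smul_eq_mul]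
  linarith

end SuInvariants

theorem mainTheorem10 (n : ℕ) (hn : 2 ≤ n) :
    -- the tensors `k⁽ᵐ⁾` are the symmetric traces, and are symmetric and invariant
    (∀ (m : ℕ) (X : Fin m → SuInvariants.su n),
      SuInvariants.symTrace (fun j => (X j : Matrix (Fin n) (Fin n) ℂ)) =
        (-Complex.I) ^ m * (SuInvariants.k n m X : ℂ)) ∧
    (∀ m : ℕ, SuInvariants.k n m ∈ SuInvariants.invSymm n m) ∧
    -- there are `l = n - 1` primitive ones: `k⁽²⁾, …, k⁽ⁿ⁾` are primitive, each is the only one of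
    -- its order up to a factor and products of lower order tensors, and there are no others
    (∀ m : ℕ, 2 ≤ m → m ≤ n →
      SuInvariants.IsPrimitive (SuInvariants.k n m) ∧
      ∀ h ∈ SuInvariants.invSymm n m,
        ∃! c : ℝ, h - c • SuInvariants.k n m ∈ SuInvariants.decomposable n m) ∧
    (∀ m : ℕ, (∃ h : SuInvariants.Tensor n m, SuInvariants.IsPrimitive h) ↔ 2 ≤ m ∧ m ≤ n) ∧
    -- the products of `k⁽²⁾, …, k⁽ⁿ⁾` form a basis of the invariant symmetric tensors
    (∀ m : ℕ,
      LinearIndependent ℝ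
        (fun μ : SuInvariants.Monomials n m => SuInvariants.kPart n μ.1) ∧
      Submodule.span ℝ
        (Set.range fun μ : SuInvariants.Monomials n m => SuInvariants.kPart n μ.1) =
          SuInvariants.invSymm n m) ∧
    -- in particular the higher symmetric traces are not primitive, and are combinations of
    -- products of `k⁽²⁾, …, k⁽ⁿ⁾`
    (∀ m : ℕ, n < m →
      SuInvariants.k n m ∈ SuInvariants.decomposable n m ∧
      SuInvariants.k n m ∈ Submodule.span ℝ
        (Set.range fun μ : SuInvariants.Monomials n m => SuInvariants.kPart n μ.1)) ∧
    -- the antisymmetrisation of `n × n` matrices in more than `n` indices vanishes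
    (∀ m : ℕ, n < m → ∀ A : Fin m → Matrix (Fin n) (Fin n) ℂ,
      SuInvariants.antisymTrace A = 0) ∧
    -- its expansion into products of symmetric traces
    (∀ (m : ℕ) (X : Fin m → SuInvariants.su n),
      SuInvariants.antisymTrace
          (fun j => Complex.I • (X j : Matrix (Fin n) (Fin n) ℂ)) =
        ((∑ μ : m.Partition, SuInvariants.cycleSign μ * SuInvariants.cauchyNumber μ *
          SuInvariants.kPart n μ X : ℝ) : ℂ)) ∧
    -- the resulting relation, which gives `k⁽ᵐ⁾` in terms of products of lower order
    (∀ m : ℕ, n < m →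
      ((-1 : ℝ) ^ m * ((m - 1).factorial : ℝ)) • SuInvariants.k n m =
        ∑ μ ∈ (Finset.univ : Finset m.Partition).erase (Nat.Partition.indiscrete m),
          (SuInvariants.cycleSign μ * SuInvariants.cauchyNumber μ) • SuInvariants.kPart n μ) := by
  have hn' : 0 < n := by omega
  refine ⟨fun m X => SuInvariants.symTrace_eq X, SuInvariants.k_mem n, fun m h2 hmn => ⟨?_, ?_⟩,
    fun m => ⟨?_, ?_⟩, fun m => ⟨SuInvariants.linearIndependent_kPart hn' m,
      SuInvariants.span_kPart hn' m⟩, fun m hm => ⟨?_, ?_⟩,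
    fun m hm A => SuInvariants.antisymTrace_eq_zero hm A,
    fun m X => SuInvariants.antisymTrace_expansion X, fun m hm => SuInvariants.smul_k_eq_sum hm⟩
  · exact ⟨by omega, SuInvariants.k_mem n m, SuInvariants.k_notMem_decomposable h2 hmn⟩
  · intro h hh
    obtain ⟨c, hc⟩ := SuInvariants.exists_sub_smul_k_mem hn' (by omega) hh
    refine ⟨c, hc, fun d hd => ?_⟩
    by_contra hne
    refine SuInvariants.k_notMem_decomposable h2 hmn ?_
    -- Two admissible coefficients `c ≠ d` would make `(d - c) k⁽ᵐ⁾` decomposable, as the difference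
    -- of `h - c k⁽ᵐ⁾` and `h - d k⁽ᵐ⁾`.
    have h3 := Submodule.smul_mem _ (d - c)⁻¹ (Submodule.sub_mem _ hc hd)
    have hdc : d - c ≠ 0 := sub_ne_zero.mpr hne
    convert! h3 using 1
    ext X
    simp only [smul_apply, sub_apply, smul_eq_mul]
    field_simp
    ring
  · rintro ⟨h, hm, hh, hd⟩
    by_contra hne
    exact hd (SuInvariants.invSymm_le_decomposable hn' hm hne hh)
  · rintro ⟨h2, hmn⟩
    exact ⟨_, by omega, SuInvariants.k_mem n m, SuInvariants.k_notMem_decomposable h2 hmn⟩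
  · exact SuInvariants.invSymm_le_decomposable hn' (by omega) (by omega) (SuInvariants.k_mem n m)
  · rw [SuInvariants.span_kPart hn']
    exact SuInvariants.k_mem n m
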